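/- Label the nodes of the affine Dynkin diagram $E_8^{(1)}$ by $1-2-3-4-5-6-4'-2'$, with $3'$ attached to $6$ (node $1$ is the affine node). Let $\alpha_i,\alpha_i^\vee$ be the simple roots and coroots, $\Phi^+$ the positive roots of the finite $E_8$ obtained by deleting node $1$, $\rho=\frac12\sum_{\alpha\in\Phi^+}\alpha$, and $\langle\cdot,\cdot\rangle$ the Weyl-invariant form on $\mathbb Z\Phi^\vee$ with $\langle\alpha_i^\vee,\alpha_i^\vee\rangle=2$. Coweights are the elements of $\widehat Y=\mathbb Z d\oplus\bigoplus_i\mathbb Z\alpha_i^\vee$, paired with roots by the generalized Cartan matrix and $d(\alpha_1)=1$, $d(\alpha_i)=0$ for $i\ne1$. With $c=\sum_{i=1}^6 i\alpha_i^\vee+4\alpha_{4'}^\vee+3\alpha_{3'}^\vee+2\alpha_{2'}^\vee$, write $\lambda=kd+\overline\lambda+nc$ with $\overline\lambda\in\mathbb Z\Phi^\vee$, i.e. $\lambda=(k,\overline\lambda,n)$, where $k$ is the level. Put $n_i=\lambda(\alpha_i)$; $\lambda$ is dominant if all $n_i\ge 0$. Write $\lambda\le\mu$ if $\mu-\lambda$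 is a non-negative integer combination of the simple coroots $\alpha_i^\vee$ (including $\alpha_1^\vee$). Let $$N_\rho(\lambda)=\sum_{i=1}^6n_i+\min\Big(\Big\lfloor\frac{n_{3'}+n_{4'}}2\Big\rfloor,\Big\lfloor\frac{n_{2'}+n_{3'}+2n_{4'}}3\Big\rfloor\Big)$$ and call $\lambda=(k,\overline\lambda,n)$ admissible if $n\le N_\rho(\lambda)-k$. Define $$\begin{aligned}a(\lambda)=&-\tfrac32\overline\lambda(\rho)-\tfrac{16}7\langle\overline\lambda,\overline\lambda\rangle\big[-15n+k(6n^2-6kn+2k^2+13)\big]+\tfrac{48}7\langle\overline\lambda,\overline\lambda\rangle^2(k-n)\\&+\tfrac1{420}\Big[-502+14415k+251k^2+3680k^3+576k^5-(18900+12960k^2+2880k^4)n\\&\qquad+2880k(5+2k^2)n^2-3840k^2n^3+400\sum_{\alpha\in\Phi^+}\lambda(\alpha)^3-96\sum_{\alpha\in\Phi^+}\overline\lambda(\alpha)^5\Big].\end{aligned}$$ Then: (1) Let $\lambda$ be an admissible dominant coweight of level $k>1$. Then $\Delta a=a(\lambda)-a(\mu)>0$ whenever - (type i) $\mu=\lambda+\hat\alpha_I^\vee$,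 where $I$ is a connected component of the subdiagram of nodes $i$ with $n_i=0$ and $\hat\alpha_I^\vee$ is the highest coroot of the finite root subsystem spanned by $I$; or - (type ii) $\mu=\lambda+\alpha_i^\vee$, where $i$ is a node such that $n_j>0$ for every node $j$ joined to $i$ by an edge. (2) Consequently $a$ strictly decreases along every flow in the Hasse diagram of admissible dominant coweights of level $k>1$: if $\lambda,\mu$ are admissible dominant coweights of level $k>1$ with $\lambda\le\mu$ and $\lambda\ne\mu$, then $a(\mu)<a(\lambda)$. -/

import Mathlib

/-- The nine nodes of the affine Dynkin diagram `E₈⁽¹⁾`, named by their Coxeter labels: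
`a1, …, a6` are the unprimed labels `1, …, 6` (with `a1` the affine node) and
`b4, b3, b2` are the primed labels `4', 3', 2'`. -/
inductive Node : Type
  | a1 | a2 | a3 | a4 | a5 | a6 | b4 | b3 | b2
  deriving DecidableEq

instance : Fintype Node where
  elems := {.a1, .a2, .a3, .a4, .a5, .a6, .b4, .b3, .b2}
  complete i := by cases i <;> decide

namespace AffineE8

open Node

/-- The affine Dynkin diagram `1 - 2 - 3 - 4 - 5 - 6 - 4' - 2'`, with `3'` attached to `6`. -/
def dynkin : SimpleGraph Node :=
  SimpleGraph.fromRel fun i j =>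
    (i, j) ∈ [(a1, a2), (a2, a3), (a3, a4), (a4, a5), (a5, a6), (a6, b4), (a6, b3), (b4, b2)]

/-- The Coxeter label of a node, read without primes. -/
def mark : Node → ℤ
  | a1 => 1
  | a2 => 2
  | a3 => 3
  | a4 => 4
  | a5 => 5
  | a6 => 6
  | b4 => 4
  | b3 => 3
  | b2 => 2

instance : DecidableRel dynkin.Adj := fun i j =>
  inferInstanceAs (Decidable (i ≠ j ∧ (_ ∨ _)))

/-- The generalized Cartan matrix of `E₈⁽¹⁾`. -/
def cartan (i j : Node) : ℤ :=
  if i = j then 2 else if dynkin.Adj i j then -1 else 0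

/-- The affine root lattice and the affine coroot lattice, both in coordinates with respect to
the simple (co)roots. The type is simply laced, so a root and its coroot have the same
coordinates. -/
abbrev RootLattice : Type := Node → ℤ

/-- The simple root `α_i`, or the simple coroot `α_i^∨`. -/
def simple (i : Node) : RootLattice := Pi.single i 1

/-- The pairing of the coroot with coordinates `x` and the root with coordinates `y`. On
`ℤΦ^∨` it is also the Weyl-invariant bilinear form. -/
def form (x y : RootLattice) : ℤ := ∑ i, ∑ j, x i * cartan i j * y j

/-- The root subsystem spanned by a set `I` of nodes: the orbit of the simple roots `α_i`, `i ∈ I`,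
under the group generated by the simple reflections `s_i`, `i ∈ I`. -/
inductive IsRootOf (I : Set Node) : RootLattice → Prop
  | simple (i : Node) (hi : i ∈ I) : IsRootOf I (simple i)
  | reflect (i : Node) (hi : i ∈ I) (β : RootLattice) (hβ : IsRootOf I β) :
      IsRootOf I (β - form (AffineE8.simple i) β • AffineE8.simple i)

/-- The set `Φ⁺` of positive roots of the finite root system `E₈`. -/
def posRoots : Set RootLattice := {α | IsRootOf {i | i ≠ a1} α ∧ 0 ≤ α}

/-- `β` is the highest (co)root of the root subsystem spanned by `I`. -/
def IsHighestRoot (I : Set Node) (β : RootLattice) : Prop :=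
  IsGreatest {γ | IsRootOf I γ} β

/-- The coweight lattice `ℤ d ⊕ ℤΦ_aff^∨`; the pair `(k, x)` is `k d + ∑ x_i α_i^∨`. -/
abbrev Coweight : Type := ℤ × RootLattice

/-- A coroot-lattice element as a coweight. -/
def ofCoroot (β : RootLattice) : Coweight := (0, β)

/-- The pairing `l(α)` of a coweight with an element of the affine root lattice, where
`d(α_1) = 1` and `d(α_i) = 0` for `i ≠ 1`. -/
def pair (l : Coweight) (α : RootLattice) : ℤ := l.1 * α a1 + form l.2 α

/-- The Kac coefficient `n_i = l(α_i)`. -/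
def kac (l : Coweight) (i : Node) : ℤ := pair l (simple i)

/-- A coweight is dominant if all its Kac coefficients are non-negative. -/
def Dominant (l : Coweight) : Prop := ∀ i, 0 ≤ kac l i

/-- The level `k = l(δ) = ∑ mark i * n_i`, where `δ = ∑ mark i * α_i` is the minimal positive
imaginary root. -/
def level (l : Coweight) : ℤ := pair l mark

/-- The coefficient `n` of the central element `c = ∑ mark i * α_i^∨` in the decomposition
`ℤ d ⊕ ℤΦ^∨ ⊕ ℤ c`. -/
def central (l : Coweight) : ℤ := l.2 a1

/-- The component of `l` in `ℤΦ^∨` in the decomposition `ℤ d ⊕ ℤΦ^∨ ⊕ ℤ c`. -/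
def bar (l : Coweight) : RootLattice := l.2 - central l • mark

/-- The dominance order: `m - l` is a non-negative integer combination of simple coroots. -/
def Le (l m : Coweight) : Prop :=
  ∃ x : Node → ℕ, m - l = ∑ i, x i • ofCoroot (simple i)

/-- The number `N_ρ` of fractional instantons. -/
noncomputable def fracInst (l : Coweight) : ℤ :=
  kac l a1 + kac l a2 + kac l a3 + kac l a4 + kac l a5 + kac l a6
    + min (Int.floor (((kac l b3 + kac l b4 : ℤ) : ℚ) / 2))
        (Int.floor (((kac l b2 + kac l b3 + 2 * kac l b4 : ℤ) : ℚ) / 3))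

/-- The condition `n ≤ N_ρ - k`: the total number `-n + N_ρ` of full and fractional instantons is
at least `k`. -/
def Admissible (l : Coweight) : Prop := central l ≤ fracInst l - level l

/-- `x(ρ)`, where `ρ` is half the sum of the positive roots of `E₈`. -/
noncomputable def height (x : RootLattice) : ℚ :=
  (1 / 2 : ℚ) * (∑ᶠ α ∈ posRoots, (form x α : ℚ))

/-- The `a` anomaly as a polynomial in the level `k`, the central coefficient `n`, the height
`h`, the squared length `L`, and the sums `S₃`, `S₅` of third and fifth powers over the positive
roots. -/
def anomalyPoly (k n h L S₃ S₅ : ℚ) : ℚ :=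
  -(3 / 2) * h
    - (16 / 7) * L * (-15 * n + k * (6 * n ^ 2 - 6 * k * n + 2 * k ^ 2 + 13))
    + (48 / 7) * L ^ 2 * (k - n)
    + (1 / 420) *
      (-502 + 14415 * k + 251 * k ^ 2 + 3680 * k ^ 3 + 576 * k ^ 5
        - (18900 + 12960 * k ^ 2 + 2880 * k ^ 4) * n
        + 2880 * k * (5 + 2 * k ^ 2) * n ^ 2
        - 3840 * k ^ 2 * n ^ 3
        + 400 * S₃ - 96 * S₅)

/-- The `a` anomaly `a(l)`. -/
noncomputable def anomaly (l : Coweight) : ℚ :=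
  anomalyPoly (level l) (central l) (height (bar l)) (form (bar l) (bar l))
    (∑ᶠ α ∈ posRoots, (pair l α : ℚ) ^ 3)
    (∑ᶠ α ∈ posRoots, (form (bar l) α : ℚ) ^ 5)

/-- `I` is (the node set of) a connected component of the subdiagram of zeros of the Kac diagram
of `l`. -/
def IsZeroComponent (l : Coweight) (I : Set Node) : Prop :=
  ∃ C : (dynkin.induce {i | kac l i = 0}).ConnectedComponent, I = Subtype.val '' C.supp

end AffineE8

namespace AffineE8

open Node

theorem sum_node {M : Type*} [AddCommMonoid M] (f : Node → M) :
    ∑ i, f i = f a1 + (f a2 + (f a3 + (f a4 + (f a5 + (f a6 + (f b4 + (f b3 + f b2))))))) := by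
  have h : (Finset.univ : Finset Node) = {a1, a2, a3, a4, a5, a6, b4, b3, b2} := rfl
  rw [h]
  repeat rw [Finset.sum_insert (by decide)]
  rw [Finset.sum_singleton]

theorem form_eq (x y : RootLattice) : form x y =
    2 * (x a1 * y a1 + x a2 * y a2 + x a3 * y a3 + x a4 * y a4 + x a5 * y a5 + x a6 * y a6
      + x b4 * y b4 + x b3 * y b3 + x b2 * y b2)
    - (x a1 * y a2 + x a2 * y a1) - (x a2 * y a3 + x a3 * y a2) - (x a3 * y a4 + x a4 * y a3)
    - (x a4 * y a5 + x a5 * y a4) - (x a5 * y a6 + x a6 * y a5) - (x a6 * y b4 + x b4 * y a6)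
    - (x a6 * y b3 + x b3 * y a6) - (x b4 * y b2 + x b2 * y b4) := by
  simp only [form, sum_node, cartan, dynkin, SimpleGraph.fromRel_adj]
  simp
  ring

theorem form_comm (x y : RootLattice) : form x y = form y x := by
  simp only [form_eq]; ring

theorem form_add_left (x y z : RootLattice) : form (x + y) z = form x z + form y z := by
  simp only [form_eq, Pi.add_apply]; ring

theorem form_sub_left (x y z : RootLattice) : form (x - y) z = form x z - form y z := by
  simp only [form_eq, Pi.sub_apply]; ring

theorem form_neg_left (x z : RootLattice) : form (-x) z = -form x z := by
  simp only [form_eq, Pi.neg_apply]; ring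

theorem form_smul_left (m : ℤ) (x z : RootLattice) : form (m • x) z = m * form x z := by
  simp only [form_eq, Pi.smul_apply, smul_eq_mul]; ring

theorem form_add_right (x y z : RootLattice) : form x (y + z) = form x y + form x z := by
  simp only [form_eq, Pi.add_apply]; ring

theorem form_sub_right (x y z : RootLattice) : form x (y - z) = form x y - form x z := by
  simp only [form_eq, Pi.sub_apply]; ring

theorem form_neg_right (x z : RootLattice) : form x (-z) = -form x z := by
  simp only [form_eq, Pi.neg_apply]; ring

theorem form_smul_right (m : ℤ) (x z : RootLattice) : form x (m • z) = m * form x z := by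
  simp only [form_eq, Pi.smul_apply, smul_eq_mul]; ring

theorem form_zero_left (x : RootLattice) : form 0 x = 0 := by
  simp [form_eq]

theorem simple_apply (i j : Node) : simple i j = if j = i then 1 else 0 := by
  simp [simple, Pi.single_apply]

theorem form_simple_right (x : RootLattice) (j : Node) : form x (simple j) =
    match j with
    | a1 => 2 * x a1 - x a2
    | a2 => 2 * x a2 - x a1 - x a3
    | a3 => 2 * x a3 - x a2 - x a4
    | a4 => 2 * x a4 - x a3 - x a5
    | a5 => 2 * x a5 - x a4 - x a6
    | a6 => 2 * x a6 - x a5 - x b4 - x b3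
    | b4 => 2 * x b4 - x a6 - x b2
    | b3 => 2 * x b3 - x a6
    | b2 => 2 * x b2 - x b4 := by
  cases j <;> simp [form_eq, simple_apply]

theorem form_simple_self (j : Node) : form (simple j) (simple j) = 2 := by
  cases j <;> simp [form_simple_right, simple_apply]

theorem form_simple_simple (i j : Node) : form (simple i) (simple j) = cartan i j := by
  revert i j
  decide

theorem form_eq_sum (x y : RootLattice) : form x y = ∑ j, y j * form x (simple j) := by
  rw [sum_node, form_eq]
  simp only [form_simple_right]
  ring

theorem form_mark_right (x : RootLattice) : form x mark = 0 := by
  simp only [form_eq, mark]; ring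

theorem form_mark_left (x : RootLattice) : form mark x = 0 := by
  rw [form_comm, form_mark_right]

theorem mark_pos (i : Node) : 1 ≤ mark i := by cases i <;> decide

theorem form_self_sum_sq (y : RootLattice) : 360 * form y y =
    180 * (2 * y a1 - y a2) ^ 2 + 60 * (3 * y a2 - 2 * y a3) ^ 2 + 30 * (4 * y a3 - 3 * y a4) ^ 2
    + 18 * (5 * y a4 - 4 * y a5) ^ 2 + 12 * (6 * y a5 - 5 * y a6) ^ 2
    + 15 * (4 * y a6 - 6 * y b4) ^ 2 + 20 * (3 * y a6 - 6 * y b3) ^ 2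
    + 45 * (2 * y b4 - 4 * y b2) ^ 2 := by
  simp only [form_eq]; ring

theorem form_self_nonneg (y : RootLattice) : 0 ≤ form y y := by
  have h := form_self_sum_sq y
  have : 0 ≤ 360 * form y y := by rw [h]; positivity
  omega

/-- The radical of the form is spanned by `mark`. -/
theorem eq_smul_mark_of_form_self {y : RootLattice} (h : form y y = 0) : y = y a1 • mark := by
  have e := form_self_sum_sq y
  rw [h] at e
  have z1 : 2 * y a1 - y a2 = 0 := by
    rw [← sq_eq_zero_iff]; nlinarith
  have z2 : 3 * y a2 - 2 * y a3 = 0 := by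
    rw [← sq_eq_zero_iff]; nlinarith
  have z3 : 4 * y a3 - 3 * y a4 = 0 := by
    rw [← sq_eq_zero_iff]; nlinarith
  have z4 : 5 * y a4 - 4 * y a5 = 0 := by
    rw [← sq_eq_zero_iff]; nlinarith
  have z5 : 6 * y a5 - 5 * y a6 = 0 := by
    rw [← sq_eq_zero_iff]; nlinarith
  have z6 : 4 * y a6 - 6 * y b4 = 0 := by
    rw [← sq_eq_zero_iff]; nlinarith
  have z7 : 3 * y a6 - 6 * y b3 = 0 := by
    rw [← sq_eq_zero_iff]; nlinarith
  have z8 : 2 * y b4 - 4 * y b2 = 0 := by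
    rw [← sq_eq_zero_iff]; nlinarith
  funext i
  cases i <;> simp only [Pi.smul_apply, smul_eq_mul, mark] <;> omega

theorem eq_zero_of_form_self {y : RootLattice} {j : Node} (hj : y j = 0) (h : form y y = 0) :
    y = 0 := by
  have e := eq_smul_mark_of_form_self h
  have h1 : y a1 = 0 := by
    have := congrFun e j
    rw [hj, Pi.smul_apply, smul_eq_mul] at this
    rcases mul_eq_zero.1 this.symm with h | h
    · exact h
    · have := mark_pos j; omega
  rw [e, h1, zero_smul]

theorem two_le_form_self {y : RootLattice} {j : Node} (hj : y j = 0) (hy : y ≠ 0) :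
    2 ≤ form y y := by
  have h0 := form_self_nonneg y
  have h1 : form y y ≠ 0 := fun h => hy (eq_zero_of_form_self hj h)
  have h2 : 2 ∣ form y y := by
    rw [form_eq]
    refine ⟨y a1 * y a1 + y a2 * y a2 + y a3 * y a3 + y a4 * y a4 + y a5 * y a5 + y a6 * y a6
      + y b4 * y b4 + y b3 * y b3 + y b2 * y b2 - y a1 * y a2 - y a2 * y a3 - y a3 * y a4
      - y a4 * y a5 - y a5 * y a6 - y a6 * y b4 - y a6 * y b3 - y b4 * y b2, by ring⟩
  omega

theorem form_nonpos_of_disjoint {p q : RootLattice} (hp : 0 ≤ p) (hq : 0 ≤ q)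
    (h : ∀ i, p i * q i = 0) : form p q ≤ 0 := by
  have m : ∀ i j, 0 ≤ p i * q j := fun i j => mul_nonneg (hp i) (hq j)
  rw [form_eq]
  linarith [h a1, h a2, h a3, h a4, h a5, h a6, h b4, h b3, h b2, m a1 a2, m a2 a1, m a2 a3,
    m a3 a2, m a3 a4, m a4 a3, m a4 a5, m a5 a4, m a5 a6, m a6 a5, m a6 b4, m b4 a6, m a6 b3,
    m b3 a6, m b4 b2, m b2 b4]

theorem posPart_mul_negPart (y : RootLattice) (i : Node) : y⁺ i * y⁻ i = 0 := by
  rw [Pi.posPart_apply, Pi.negPart_apply]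
  rcases le_total 0 (y i) with h | h
  · rw [negPart_eq_zero.2 h, mul_zero]
  · rw [posPart_eq_zero.2 h, zero_mul]

theorem form_posPart_negPart_nonpos (y : RootLattice) : form y⁺ y⁻ ≤ 0 :=
  form_nonpos_of_disjoint (posPart_nonneg y) (negPart_nonneg y) (posPart_mul_negPart y)

/-- A real root is either positive or negative. -/
theorem nonneg_or_nonpos_of_form_self {y : RootLattice} {j : Node} (hj : y j = 0)
    (h : form y y = 2) : 0 ≤ y ∨ y ≤ 0 := by
  by_contra! hc
  have hp : y⁺ ≠ 0 := fun e => hc.2 (posPart_eq_zero.1 e)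
  have hq : y⁻ ≠ 0 := fun e => hc.1 (negPart_eq_zero.1 e)
  have hpj : y⁺ j = 0 := by rw [Pi.posPart_apply, hj, posPart_zero]
  have hqj : y⁻ j = 0 := by rw [Pi.negPart_apply, hj, negPart_zero]
  have h1 := two_le_form_self hpj hp
  have h2 := two_le_form_self hqj hq
  have h3 := form_posPart_negPart_nonpos y
  have h4 : form y y = form y⁺ y⁺ + form y⁻ y⁻ - 2 * form y⁺ y⁻ := by
    conv_lhs => rw [← posPart_sub_negPart y]
    rw [form_sub_left, form_sub_right, form_sub_right, form_comm y⁻ y⁺]; ring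
  omega

theorem form_self_reflect {γ : RootLattice} (hγ : form γ γ = 2) (x : RootLattice) :
    form (x - form γ x • γ) (x - form γ x • γ) = form x x := by
  rw [form_sub_left, form_sub_right, form_sub_right, form_smul_left, form_smul_left,
    form_smul_right, form_smul_right, hγ, form_comm x γ]
  ring

theorem IsRootOf.form_self {I : Set Node} {γ : RootLattice} (h : IsRootOf I γ) :
    form γ γ = 2 := by
  induction h with
  | simple i hi => exact form_simple_self i
  | reflect i hi β hβ ih => rw [form_self_reflect (form_simple_self i), ih]

theorem IsRootOf.apply_eq_zero {I : Set Node} {γ : RootLattice} (h : IsRootOf I γ) {j : Node}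
    (hj : j ∉ I) : γ j = 0 := by
  induction h with
  | simple i hi =>
    rw [simple_apply, if_neg]; rintro rfl; exact hj hi
  | reflect i hi β hβ ih =>
    have : j ≠ i := by rintro rfl; exact hj hi
    simp [ih, simple_apply, this]

/-- A root of a proper subdiagram pairing to at least `2` with a simple root is that simple
root. -/
theorem eq_simple_of_two_le {γ : RootLattice} {j m : Node} (hm : γ m = 0) (hjm : j ≠ m)
    (hγ : form γ γ = 2) (h : 2 ≤ form γ (simple j)) : γ = simple j := by
  have h0 := form_self_nonneg (γ - simple j)
  have h1 : form (γ - simple j) (γ - simple j) = 4 - 2 * form γ (simple j) := by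
    rw [form_sub_left, form_sub_right, form_sub_right, hγ, form_simple_self,
      form_comm (simple j) γ]; ring
  have h2 : form (γ - simple j) (γ - simple j) = 0 := by omega
  refine sub_eq_zero.1 (eq_zero_of_form_self (j := m) ?_ h2)
  simp [hm, simple_apply, hjm.symm]

theorem form_self_sub_simple {γ : RootLattice} {j : Node} (hγ : form γ γ = 2)
    (h : form γ (simple j) = 1) : form (γ - simple j) (γ - simple j) = 2 := by
  rw [form_sub_left, form_sub_right, form_sub_right, hγ, form_simple_self,
    form_comm (simple j) γ, h]; norm_num

theorem exists_pos_of_form_pos {x y : RootLattice} (hy : 0 ≤ y) (h : 0 < form x y) :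
    ∃ j, 1 ≤ y j ∧ 1 ≤ form x (simple j) := by
  by_contra! hc
  rw [form_eq_sum] at h
  refine absurd h (not_lt.2 (Finset.sum_nonpos fun j _ => ?_))
  rcases (hy j).lt_or_eq with h1 | h1
  · have := hc j h1
    exact mul_nonpos_of_nonneg_of_nonpos (hy j) (by omega)
  · rw [← h1]; simp

/-- A positive real root of a proper subdiagram is a root in the sense of reflections. -/
theorem isRootOf_of_form_self {I : Set Node} {m : Node} (hm : m ∉ I) {γ : RootLattice}
    (h0 : 0 ≤ γ) (hI : ∀ j ∉ I, γ j = 0) (hγ : form γ γ = 2) : IsRootOf I γ := by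
  obtain ⟨n, hn⟩ : ∃ n : ℕ, ∑ i, γ i ≤ n := ⟨(∑ i, γ i).toNat, Int.self_le_toNat _⟩
  induction n generalizing γ with
  | zero =>
    have : γ = 0 := by
      have hs : ∑ i, γ i = 0 := le_antisymm (by simpa using hn) (Finset.sum_nonneg fun i _ => h0 i)
      funext i
      exact (Finset.sum_eq_zero_iff_of_nonneg (fun i _ => h0 i)).1 hs i (Finset.mem_univ i)
    rw [this, form_zero_left] at hγ
    omega
  | succ n ih =>
    obtain ⟨j, hj, hf⟩ := exists_pos_of_form_pos (x := γ) h0 (by omega)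
    have hjI : j ∈ I := by
      by_contra h
      have := hI j h; omega
    have hjm : j ≠ m := by rintro rfl; exact hm hjI
    by_cases h2 : 2 ≤ form γ (simple j)
    · rw [eq_simple_of_two_le (hI m hm) hjm hγ h2]; exact .simple j hjI
    · have h1 : form γ (simple j) = 1 := by omega
      have hr : IsRootOf I (γ - simple j) := by
        refine ih (fun i => ?_) (fun i hi => ?_) (form_self_sub_simple hγ h1) ?_
        · have := h0 i
          simp only [Pi.zero_apply, Pi.sub_apply, simple_apply] at this ⊢
          split_ifs with h
          · subst h; omega
          · omega
        · have : i ≠ j := by rintro rfl; exact hi hjI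
          simp [hI i hi, simple_apply, this]
        · have : ∑ i, simple j i = 1 := by simp [simple_apply]
          simp only [Pi.sub_apply, Finset.sum_sub_distrib, this]
          push_cast at hn; omega
      have := IsRootOf.reflect j hjI _ hr
      rwa [form_comm, form_sub_left, h1, form_simple_self, show (1 : ℤ) - 2 = -1 by norm_num,
        neg_one_smul, sub_neg_eq_add, sub_add_cancel] at this

/-- A dominant element with full support on a proper subdiagram dominates all roots. -/
theorem root_le_of_dominant {I : Set Node} {m : Node} (hm : m ∉ I) {y : RootLattice}
    (hy1 : ∀ j ∈ I, 1 ≤ y j) (hy0 : ∀ j ∉ I, y j = 0) (hd : ∀ j ∈ I, 0 ≤ form y (simple j))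
    {γ : RootLattice} (hI : ∀ j ∉ I, γ j = 0) (hγ : form γ γ = 2) : γ ≤ y := by
  have hy : 0 ≤ y := fun j => by
    by_cases h : j ∈ I
    · have := hy1 j h; simp; omega
    · simp [hy0 j h]
  obtain ⟨n, hn⟩ : ∃ n : ℕ, ∑ i, γ i ≤ n := ⟨(∑ i, γ i).toNat, Int.self_le_toNat _⟩
  induction n generalizing γ with
  | zero =>
    rcases nonneg_or_nonpos_of_form_self (hI m hm) hγ with h0 | h0
    · have hs : ∑ i, γ i = 0 := le_antisymm (by simpa using hn) (Finset.sum_nonneg fun i _ => h0 i)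
      have : γ = 0 := by
        funext i
        exact (Finset.sum_eq_zero_iff_of_nonneg (fun i _ => h0 i)).1 hs i (Finset.mem_univ i)
      rwa [this]
    · exact h0.trans hy
  | succ n ih =>
    by_contra hc
    have hq : (γ - y)⁺ ≠ 0 := fun e => hc (by simpa using posPart_eq_zero.1 e)
    have hqm : (γ - y)⁺ m = 0 := by
      rw [Pi.posPart_apply, Pi.sub_apply, hI m hm, hy0 m hm, sub_zero, posPart_zero]
    have h1 := two_le_form_self hqm hq
    have h2 := form_posPart_negPart_nonpos (γ - y)
    have h3 : form (γ - y)⁺ (γ - y)⁺ - form (γ - y)⁺ (γ - y)⁻ =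
        form γ (γ - y)⁺ - form y (γ - y)⁺ := by
      rw [← form_sub_right, posPart_sub_negPart, form_sub_right, form_comm _ γ, form_comm _ y]
    have h4 : 0 ≤ form y (γ - y)⁺ := by
      rw [form_eq_sum]
      refine Finset.sum_nonneg fun j _ => ?_
      by_cases h : j ∈ I
      · exact mul_nonneg (posPart_nonneg (γ - y) j) (hd j h)
      · rw [Pi.posPart_apply, Pi.sub_apply, hI j h, hy0 j h, sub_zero, posPart_zero, zero_mul]
    obtain ⟨j, hj, hf⟩ := exists_pos_of_form_pos (x := γ) (posPart_nonneg (γ - y)) (by omega)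
    have hlt : y j < γ j := by
      by_contra h
      rw [Pi.posPart_apply, posPart_eq_zero.2 (by simp; omega)] at hj
      omega
    have hjI : j ∈ I := by
      by_contra h
      have := hI j h; have := hy0 j h; omega
    have hjm : j ≠ m := by rintro rfl; exact hm hjI
    have hyj := hy1 j hjI
    have hne : ¬ 2 ≤ form γ (simple j) := fun h => by
      have := eq_simple_of_two_le (hI m hm) hjm hγ h
      rw [this, simple_apply, if_pos rfl] at hlt
      omega
    have hle : γ - simple j ≤ y := by
      refine ih (fun i hi => ?_) (form_self_sub_simple hγ (by omega)) ?_
      · have : i ≠ j := by rintro rfl; exact hi hjI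
        simp [hI i hi, simple_apply, this]
      · have : ∑ i, simple j i = 1 := by simp [simple_apply]
        simp only [Pi.sub_apply, Finset.sum_sub_distrib, this]
        push_cast at hn; omega
    have hqs : (γ - y)⁺ = simple j := by
      funext i
      have hi := hle i
      rw [Pi.posPart_apply, simple_apply]
      simp only [Pi.sub_apply, simple_apply] at hi ⊢
      split_ifs at hi ⊢ with h
      · subst h
        rw [posPart_eq_self.2 (by omega)]; omega
      · rw [posPart_eq_zero.2 (by omega)]
    rw [hqs] at h3 h4 h1 h2
    omega

/-- The highest root of the finite root system `E₈`. -/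
def theta : RootLattice := mark - simple a1

/-- The finite root system `E₈`. -/
noncomputable def finiteRoots : Finset RootLattice :=
  (Finset.Icc (-mark) mark).filter fun v => v a1 = 0 ∧ form v v = 2

/-- The finite roots pairing to `1` with `γ`. -/
noncomputable def rootsAt (γ : RootLattice) : Finset RootLattice :=
  finiteRoots.filter fun α => form γ α = 1

theorem le_theta_of_form_self {v : RootLattice} (h0 : v a1 = 0) (h : form v v = 2) :
    v ≤ theta := by
  refine root_le_of_dominant (I := {i | i ≠ a1}) (m := a1) (by simp) ?_ ?_ ?_ ?_ h
  · intro j hj; cases j <;> first | exact absurd rfl hj | decide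
  · intro j hj; cases j <;> first | rfl | exact absurd (by decide) hj
  · intro j hj
    rw [theta, form_sub_left, form_mark_left, form_simple_simple]
    cases j <;> first | exact absurd rfl hj | decide
  · intro j hj
    rw [show j = a1 by simpa using hj, h0]

theorem theta_le_mark : theta ≤ mark := by
  intro i; cases i <;> decide

theorem mem_finiteRoots {v : RootLattice} : v ∈ finiteRoots ↔ v a1 = 0 ∧ form v v = 2 := by
  rw [finiteRoots, Finset.mem_filter, Finset.mem_Icc, and_iff_right_iff_imp]
  rintro ⟨h0, h⟩
  refine ⟨?_, (le_theta_of_form_self h0 h).trans theta_le_mark⟩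
  have := (le_theta_of_form_self (v := -v) (by simp [h0])
    (by rw [form_neg_left, form_neg_right, h]; norm_num)).trans theta_le_mark
  exact neg_le.1 this

theorem neg_mem_finiteRoots {v : RootLattice} (h : v ∈ finiteRoots) : -v ∈ finiteRoots := by
  rw [mem_finiteRoots] at h ⊢
  rw [form_neg_left, form_neg_right]
  simpa using h

theorem le_mark_of_mem {v : RootLattice} (h : v ∈ finiteRoots) (i : Node) :
    -mark i ≤ v i ∧ v i ≤ mark i := by
  have h := (Finset.mem_Icc.1 (Finset.mem_filter.1 h).1)
  exact ⟨h.1 i, h.2 i⟩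

theorem nonneg_or_nonpos_of_mem {v : RootLattice} (h : v ∈ finiteRoots) : 0 ≤ v ∨ v ≤ 0 :=
  nonneg_or_nonpos_of_form_self (mem_finiteRoots.1 h).1 (mem_finiteRoots.1 h).2

theorem mem_posRoots {v : RootLattice} : v ∈ posRoots ↔ v ∈ finiteRoots ∧ 0 ≤ v := by
  rw [mem_finiteRoots]
  constructor
  · rintro ⟨h, h0⟩
    exact ⟨⟨h.apply_eq_zero (by simp), h.form_self⟩, h0⟩
  · rintro ⟨⟨h1, h2⟩, h0⟩
    refine ⟨isRootOf_of_form_self (m := a1) (by simp) h0 (fun j hj => ?_) h2, h0⟩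
    rw [show j = a1 by simpa using hj, h1]

theorem mem_rootsAt {γ α : RootLattice} :
    α ∈ rootsAt γ ↔ α ∈ finiteRoots ∧ form γ α = 1 := Finset.mem_filter

theorem sub_mem_rootsAt {γ α : RootLattice} (hγ : γ ∈ finiteRoots) (hα : α ∈ rootsAt γ) :
    γ - α ∈ rootsAt γ := by
  rw [mem_rootsAt, mem_finiteRoots] at hα ⊢
  rw [mem_finiteRoots] at hγ
  obtain ⟨⟨h1, h2⟩, h3⟩ := hα
  refine ⟨⟨by simp [h1, hγ.1], ?_⟩, ?_⟩
  · rw [form_sub_left, form_sub_right, form_sub_right, form_comm α γ, h2, h3, hγ.2]; norm_num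
  · rw [form_sub_right, h3, hγ.2]; norm_num

/-- The reflection in `γ`. -/
def rootReflection (γ x : RootLattice) : RootLattice := x - form γ x • γ

theorem form_rootReflection {γ : RootLattice} (hγ : form γ γ = 2) (x y : RootLattice) :
    form (rootReflection γ x) (rootReflection γ y) = form x y := by
  simp only [rootReflection, form_sub_left, form_sub_right, form_smul_left, form_smul_right, hγ,
    form_comm x γ]
  ring

theorem rootReflection_rootReflection {γ : RootLattice} (hγ : form γ γ = 2) (x : RootLattice) :
    rootReflection γ (rootReflection γ x) = x := by
  simp only [rootReflection, form_sub_right, form_smul_right, hγ]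
  rw [sub_sub, ← add_smul]
  ring_nf

theorem rootReflection_mem_finiteRoots {γ α : RootLattice} (hγ : γ ∈ finiteRoots)
    (hα : α ∈ finiteRoots) : rootReflection γ α ∈ finiteRoots := by
  rw [mem_finiteRoots] at *
  rw [form_rootReflection hγ.2]
  exact ⟨by simp [rootReflection, hγ.1, hα.1], hα.2⟩

theorem sum_rootsAt_rootReflection {M : Type*} [AddCommMonoid M] {β : RootLattice} (hβ : β ∈ finiteRoots)
    (γ x : RootLattice) (f : ℤ → M) :
    ∑ α ∈ rootsAt (rootReflection β γ), f (form x α) =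
      ∑ α ∈ rootsAt γ, f (form (rootReflection β x) α) := by
  have h2 := (mem_finiteRoots.1 hβ).2
  refine Finset.sum_nbij' (rootReflection β) (rootReflection β) (fun α hα => ?_) (fun α hα => ?_)
    (fun α _ => rootReflection_rootReflection h2 α)
    (fun α _ => rootReflection_rootReflection h2 α) (fun α _ => ?_)
  · rw [mem_rootsAt] at hα ⊢
    refine ⟨rootReflection_mem_finiteRoots hβ hα.1, ?_⟩
    rw [← hα.2, ← form_rootReflection h2 _ α, rootReflection_rootReflection h2]
  · rw [mem_rootsAt] at hα ⊢
    exact ⟨rootReflection_mem_finiteRoots hβ hα.1, by rw [form_rootReflection h2, hα.2]⟩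
  · rw [form_rootReflection h2]

/-- The moments of a coweight on the `56` roots pairing to `1` with the root `γ`. -/
def HasMoments (γ : RootLattice) : Prop := ∀ x : RootLattice,
  (rootsAt γ).card = 56 ∧
  ∑ α ∈ rootsAt γ, form x α = 28 * form x γ ∧
  ∑ α ∈ rootsAt γ, form x α ^ 2 = 12 * form x x + 8 * form x γ ^ 2 ∧
  ∑ α ∈ rootsAt γ, form x α ^ 3 = 18 * form x γ * form x x - 2 * form x γ ^ 3 ∧
  ∑ α ∈ rootsAt γ, form x α ^ 4 =
    6 * form x x ^ 2 + 12 * form x γ ^ 2 * form x x - 4 * form x γ ^ 4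

theorem HasMoments.refl {β γ : RootLattice} (hβ : β ∈ finiteRoots) (h : HasMoments γ) :
    HasMoments (rootReflection β γ) := by
  intro x
  have h2 := (mem_finiteRoots.1 hβ).2
  have e : ∀ y, form x (rootReflection β y) = form (rootReflection β x) y := fun y => by
    rw [← form_rootReflection h2 x, rootReflection_rootReflection h2]
  obtain ⟨m0, m1, m2, m3, m4⟩ := h (rootReflection β x)
  have c := sum_rootsAt_rootReflection hβ γ x (fun _ => (1 : ℕ))
  simp only [Finset.sum_const, smul_eq_mul, mul_one] at c
  have s1 := sum_rootsAt_rootReflection hβ γ x (fun t => t)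
  have s2 := sum_rootsAt_rootReflection hβ γ x (fun t => t ^ 2)
  have s3 := sum_rootsAt_rootReflection hβ γ x (fun t => t ^ 3)
  have s4 := sum_rootsAt_rootReflection hβ γ x (fun t => t ^ 4)
  rw [form_rootReflection h2] at m2 m3 m4
  rw [c, s1, s2, s3, s4, e]
  exact ⟨m0, m1, m2, m3, m4⟩

theorem simple_mem_finiteRoots {i : Node} (hi : i ≠ a1) : simple i ∈ finiteRoots := by
  rw [mem_finiteRoots]
  exact ⟨by simp [simple_apply, hi.symm], form_simple_self i⟩

theorem theta_mem_finiteRoots : theta ∈ finiteRoots := by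
  rw [mem_finiteRoots]
  refine ⟨by decide, ?_⟩
  rw [theta, form_sub_left, form_mark_left, form_sub_right, form_mark_right, form_simple_self]
  norm_num

theorem hasMoments_simple_of_adj {i j : Node} (hi : i ≠ a1) (hj : j ≠ a1)
    (hij : form (simple i) (simple j) = -1) (h : HasMoments (simple i)) :
    HasMoments (simple j) := by
  have := (h.refl (simple_mem_finiteRoots hj)).refl (simple_mem_finiteRoots hi)
  have e : rootReflection (simple i) (rootReflection (simple j) (simple i)) = simple j := by
    simp only [rootReflection, form_sub_right, form_smul_right, form_comm (simple j), hij,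
      form_simple_self]
    module
  rwa [e] at this

theorem hasMoments_simple {i : Node} (hi : i ≠ a1) (h : HasMoments (simple i)) :
    ∀ j, j ≠ a1 → HasMoments (simple j) := by
  have step : ∀ i j : Node, i ≠ a1 → j ≠ a1 → cartan i j = -1 →
      (HasMoments (simple i) ↔ HasMoments (simple j)) := fun i j hi hj hij => by
    constructor
    · exact hasMoments_simple_of_adj hi hj (by rw [form_simple_simple, hij])
    · exact hasMoments_simple_of_adj hj hi (by rw [form_comm, form_simple_simple, hij])
  have e3 := step a2 a3 (by decide) (by decide) (by decide)
  have e4 := step a3 a4 (by decide) (by decide) (by decide)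
  have e5 := step a4 a5 (by decide) (by decide) (by decide)
  have e6 := step a5 a6 (by decide) (by decide) (by decide)
  have f4 := step a6 b4 (by decide) (by decide) (by decide)
  have f3 := step a6 b3 (by decide) (by decide) (by decide)
  have f2 := step b4 b2 (by decide) (by decide) (by decide)
  have h2 : HasMoments (simple a2) := by 
    cases i
    · exact absurd rfl hi
    · exact h
    · exact e3.2 h
    · exact e3.2 (e4.2 h)
    · exact e3.2 (e4.2 (e5.2 h))
    · exact e3.2 (e4.2 (e5.2 (e6.2 h)))
    · exact e3.2 (e4.2 (e5.2 (e6.2 (f4.2 h))))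
    · exact e3.2 (e4.2 (e5.2 (e6.2 (f3.2 h))))
    · exact e3.2 (e4.2 (e5.2 (e6.2 (f4.2 (f2.2 h)))))
  intro j hj
  cases j
  · exact absurd rfl hj
  · exact h2
  · exact e3.1 h2
  · exact e4.1 (e3.1 h2)
  · exact e5.1 (e4.1 (e3.1 h2))
  · exact e6.1 (e5.1 (e4.1 (e3.1 h2)))
  · exact f4.1 (e6.1 (e5.1 (e4.1 (e3.1 h2))))
  · exact f3.1 (e6.1 (e5.1 (e4.1 (e3.1 h2))))
  · exact f2.1 (f4.1 (e6.1 (e5.1 (e4.1 (e3.1 h2)))))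

theorem isRootOf_of_mem {γ : RootLattice} (hγ : γ ∈ finiteRoots) (h0 : 0 ≤ γ) :
    IsRootOf {i | i ≠ a1} γ := (mem_posRoots.2 ⟨hγ, h0⟩).1

theorem theta_nonneg : 0 ≤ theta := by
  have h : ∀ i, (0 : ℤ) ≤ theta i := by decide
  exact h

theorem HasMoments.neg {γ : RootLattice} (hγ : γ ∈ finiteRoots) (h : HasMoments γ) :
    HasMoments (-γ) := by
  have := h.refl hγ
  rwa [rootReflection, (mem_finiteRoots.1 hγ).2, show γ - (2 : ℤ) • γ = -γ by module] at this

theorem hasMoments_of_theta (h : HasMoments theta) {γ : RootLattice} (hγ : γ ∈ finiteRoots) :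
    HasMoments γ := by
  have down : ∀ β, IsRootOf {i | i ≠ a1} β → HasMoments β → HasMoments (simple a2) := by
    intro β hβ
    induction hβ with
    | simple i hi => exact fun hm => hasMoments_simple hi hm a2 nofun
    | reflect i hi β hβ ih =>
      intro hm
      have h2 := hm.refl (simple_mem_finiteRoots hi)
      change HasMoments (rootReflection (simple i) (rootReflection (simple i) β)) at h2
      rw [rootReflection_rootReflection (form_simple_self i)] at h2
      exact ih h2
  have up : ∀ β, IsRootOf {i | i ≠ a1} β → HasMoments β := by
    intro β hβ
    induction hβ with
    | simple i hi =>
      exact hasMoments_simple (i := a2) (by decide)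
        (down _ (isRootOf_of_mem theta_mem_finiteRoots theta_nonneg) h) i hi
    | reflect i hi β hβ ih => exact ih.refl (simple_mem_finiteRoots hi)
  rcases nonneg_or_nonpos_of_mem hγ with h0 | h0
  · exact up γ (isRootOf_of_mem hγ h0)
  · have h1 := neg_mem_finiteRoots hγ
    have := (up _ (isRootOf_of_mem h1 (by simpa using h0))).neg h1
    rwa [neg_neg] at this

set_option synthInstance.maxSize 1000 in
instance : DecidableEq (ℤ × ℤ × ℤ × ℤ × ℤ × ℤ × ℤ) := inferInstance

/-- The element `α_2 + p α_3 + q α_4 + r α_5 + s α_6 + t α_{4'} + u α_{3'} + v α_{2'}`. -/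
def toRoot : ℤ × ℤ × ℤ × ℤ × ℤ × ℤ × ℤ → RootLattice
  | (p, q, r, s, t, u, v) => fun
    | a1 => 0
    | a2 => 1
    | a3 => p
    | a4 => q
    | a5 => r
    | a6 => s
    | b4 => t
    | b3 => u
    | b2 => v

/-- The coordinates of the `56` roots pairing to `1` with the highest root. -/
def thetaList : List (ℤ × ℤ × ℤ × ℤ × ℤ × ℤ × ℤ) := [
  (0,0,0,0,0,0,0), (1,0,0,0,0,0,0), (1,1,0,0,0,0,0), (1,1,1,0,0,0,0), (1,1,1,1,0,0,0),
  (1,1,1,1,1,0,0), (1,1,1,1,0,1,0), (1,1,1,1,1,1,0), (1,1,1,1,1,0,1), (1,1,1,2,1,1,0),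
  (1,1,1,1,1,1,1), (1,1,2,2,1,1,0), (1,1,1,2,1,1,1), (1,2,2,2,1,1,0), (1,1,2,2,1,1,1),
  (1,1,1,2,2,1,1), (2,2,2,2,1,1,0), (1,2,2,2,1,1,1), (1,1,2,2,2,1,1), (2,2,2,2,1,1,1),
  (1,2,2,2,2,1,1), (1,1,2,3,2,1,1), (2,2,2,2,2,1,1), (1,2,2,3,2,1,1), (1,1,2,3,2,2,1),
  (2,2,2,3,2,1,1), (1,2,3,3,2,1,1), (1,2,2,3,2,2,1), (2,2,3,3,2,1,1), (2,2,2,3,2,2,1),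
  (1,2,3,3,2,2,1), (2,3,3,3,2,1,1), (2,2,3,3,2,2,1), (1,2,3,4,2,2,1), (2,3,3,3,2,2,1),
  (2,2,3,4,2,2,1), (1,2,3,4,3,2,1), (2,3,3,4,2,2,1), (2,2,3,4,3,2,1), (1,2,3,4,3,2,2),
  (2,3,4,4,2,2,1), (2,3,3,4,3,2,1), (2,2,3,4,3,2,2), (2,3,4,4,3,2,1), (2,3,3,4,3,2,2),
  (2,3,4,5,3,2,1), (2,3,4,4,3,2,2), (2,3,4,5,3,3,1), (2,3,4,5,3,2,2), (2,3,4,5,3,3,2),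
  (2,3,4,5,4,2,2), (2,3,4,5,4,3,2), (2,3,4,6,4,3,2), (2,3,5,6,4,3,2), (2,4,5,6,4,3,2),
  (3,4,5,6,4,3,2)]

theorem toRoot_injective : Function.Injective toRoot := by
  rintro ⟨p, q, r, s, t, u, v⟩ ⟨p', q', r', s', t', u', v'⟩ h
  have h3 := congrFun h a3
  have h4 := congrFun h a4
  have h5 := congrFun h a5
  have h6 := congrFun h a6
  have h7 := congrFun h b4
  have h8 := congrFun h b3
  have h9 := congrFun h b2
  simp only [toRoot] at h3 h4 h5 h6 h7 h8 h9
  simp only [h3, h4, h5, h6, h7, h8, h9]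

theorem nodup_thetaList : thetaList.Nodup := by decide +kernel

theorem form_toRoot_of_mem : ∀ c ∈ thetaList,
    (fun (p, q, r, s, t, u, v) => 2 * (1 + p * p + q * q + r * r + s * s + t * t + u * u + v * v)
      - 2 * (p + p * q + q * r + r * s + s * t + s * u + t * v)) c = (2 : ℤ) := by
  decide

set_option synthInstance.maxSize 2000 in
set_option synthInstance.maxHeartbeats 400000 in
theorem thetaList_closed : ∀ p q r s t u v : ℤ, (p, q, r, s, t, u, v) ∈ thetaList →
    (2 * p - 1 - q = -1 → (p + 1, q, r, s, t, u, v) ∈ thetaList) ∧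
    (2 * q - p - r = -1 → (p, q + 1, r, s, t, u, v) ∈ thetaList) ∧
    (2 * r - q - s = -1 → (p, q, r + 1, s, t, u, v) ∈ thetaList) ∧
    (2 * s - r - t - u = -1 → (p, q, r, s + 1, t, u, v) ∈ thetaList) ∧
    (2 * t - s - v = -1 → (p, q, r, s, t + 1, u, v) ∈ thetaList) ∧
    (2 * u - s = -1 → (p, q, r, s, t, u + 1, v) ∈ thetaList) ∧
    (2 * v - t = -1 → (p, q, r, s, t, u, v + 1) ∈ thetaList) := by
  have h : ∀ c ∈ thetaList,
      (2 * c.1 - 1 - c.2.1 = -1 →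
        (c.1 + 1, c.2) ∈ thetaList) ∧
      (2 * c.2.1 - c.1 - c.2.2.1 = -1 →
        (c.1, c.2.1 + 1, c.2.2) ∈ thetaList) ∧
      (2 * c.2.2.1 - c.2.1 - c.2.2.2.1 = -1 →
        (c.1, c.2.1, c.2.2.1 + 1, c.2.2.2) ∈ thetaList) ∧
      (2 * c.2.2.2.1 - c.2.2.1 - c.2.2.2.2.1 - c.2.2.2.2.2.1 = -1 →
        (c.1, c.2.1, c.2.2.1, c.2.2.2.1 + 1, c.2.2.2.2) ∈ thetaList) ∧
      (2 * c.2.2.2.2.1 - c.2.2.2.1 - c.2.2.2.2.2.2 = -1 →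
        (c.1, c.2.1, c.2.2.1, c.2.2.2.1, c.2.2.2.2.1 + 1, c.2.2.2.2.2) ∈ thetaList) ∧
      (2 * c.2.2.2.2.2.1 - c.2.2.2.1 = -1 →
        (c.1, c.2.1, c.2.2.1, c.2.2.2.1, c.2.2.2.2.1, c.2.2.2.2.2.1 + 1, c.2.2.2.2.2.2)
          ∈ thetaList) ∧
      (2 * c.2.2.2.2.2.2 - c.2.2.2.2.1 = -1 →
        (c.1, c.2.1, c.2.2.1, c.2.2.2.1, c.2.2.2.2.1, c.2.2.2.2.2.1, c.2.2.2.2.2.2 + 1)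
          ∈ thetaList) := by
    decide +kernel
  exact fun p q r s t u v hc => h _ hc

theorem toRoot_add_simple (p q r s t u v : ℤ) (j : Node) (h1 : j ≠ a1) (h2 : j ≠ a2)
    (h : (p, q, r, s, t, u, v) ∈ thetaList)
    (hf : form (toRoot (p, q, r, s, t, u, v)) (simple j) = -1) :
    ∃ c ∈ thetaList, toRoot (p, q, r, s, t, u, v) + simple j = toRoot c := by
  obtain ⟨k3, k4, k5, k6, k7, k8, k9⟩ := thetaList_closed p q r s t u v h
  rw [form_simple_right] at hf
  cases j <;> simp only [toRoot] at hf
  · exact absurd rfl h1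
  · exact absurd rfl h2
  · refine ⟨_, k3 (by linarith), ?_⟩
    funext i; cases i <;> simp [toRoot, simple_apply]
  · refine ⟨_, k4 (by linarith), ?_⟩
    funext i; cases i <;> simp [toRoot, simple_apply]
  · refine ⟨_, k5 (by linarith), ?_⟩
    funext i; cases i <;> simp [toRoot, simple_apply]
  · refine ⟨_, k6 (by linarith), ?_⟩
    funext i; cases i <;> simp [toRoot, simple_apply]
  · refine ⟨_, k7 (by linarith), ?_⟩
    funext i; cases i <;> simp [toRoot, simple_apply]
  · refine ⟨_, k8 (by linarith), ?_⟩
    funext i; cases i <;> simp [toRoot, simple_apply]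
  · refine ⟨_, k9 (by linarith), ?_⟩
    funext i; cases i <;> simp [toRoot, simple_apply]

theorem form_theta_left (x : RootLattice) : form theta x = x a2 - 2 * x a1 := by
  rw [theta, form_sub_left, form_mark_left, form_comm, form_simple_right]
  ring

theorem mem_thetaList {α : RootLattice} (h0 : 0 ≤ α) (h1 : α a1 = 0) (h2 : α a2 = 1)
    (h : form α α = 2) : ∃ c ∈ thetaList, α = toRoot c := by
  obtain ⟨n, hn⟩ : ∃ n : ℕ, ∑ i, α i ≤ n := ⟨(∑ i, α i).toNat, Int.self_le_toNat _⟩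
  induction n generalizing α with
  | zero =>
    have hs : ∑ i, α i = 0 := le_antisymm (by simpa using hn) (Finset.sum_nonneg fun i _ => h0 i)
    have := (Finset.sum_eq_zero_iff_of_nonneg (fun i _ => h0 i)).1 hs a2 (Finset.mem_univ a2)
    omega
  | succ n ih =>
    by_cases hα : α = simple a2
    · refine ⟨(0, 0, 0, 0, 0, 0, 0), by decide, ?_⟩
      rw [hα]
      funext i; cases i <;> rfl
    have hf2 : form α (simple a2) ≤ 1 := by
      by_contra hc
      exact hα (eq_simple_of_two_le (m := a1) h1 (by decide) h (by omega))
    have hf : 0 < form α (α - simple a2) := by rw [form_sub_right]; omega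
    obtain ⟨j, hj, hfj⟩ := exists_pos_of_form_pos (y := α - simple a2) (fun i => by
      have := h0 i
      simp only [Pi.zero_apply, Pi.sub_apply, simple_apply] at this ⊢
      split_ifs with hi
      · subst hi; omega
      · omega) hf
    have hj1 : j ≠ a1 := by
      rintro rfl; simp [h1, simple_apply] at hj
    have hj2 : j ≠ a2 := by
      rintro rfl; simp [h2, simple_apply] at hj
    have hfj1 : form α (simple j) = 1 := by
      by_contra hc
      have := congrFun (eq_simple_of_two_le (m := a1) h1 hj1 h (by omega)) a2
      rw [h2, simple_apply, if_neg hj2.symm] at this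
      omega
    have hj' : 1 ≤ α j := by simpa [simple_apply, hj2] using hj
    obtain ⟨⟨p, q, r, s, t, u, v⟩, hc, he⟩ := ih (α := α - simple j) (fun i => by
      have := h0 i
      simp only [Pi.zero_apply, Pi.sub_apply, simple_apply] at this ⊢
      split_ifs with hi
      · subst hi; omega
      · omega) (by simp [h1, simple_apply, hj1.symm]) (by simp [h2, simple_apply, hj2.symm])
      (form_self_sub_simple h hfj1) (by
        have : ∑ i, simple j i = 1 := by simp [simple_apply]
        simp only [Pi.sub_apply, Finset.sum_sub_distrib, this]
        push_cast at hn; omega)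
    obtain ⟨c, hc', he'⟩ := toRoot_add_simple p q r s t u v j hj1 hj2 hc (by
      rw [← he, form_sub_left, hfj1, form_simple_self]; norm_num)
    exact ⟨c, hc', by rw [← he', ← he, sub_add_cancel]⟩

theorem rootsAt_theta :
    rootsAt theta = thetaList.toFinset.map ⟨toRoot, toRoot_injective⟩ := by
  ext α
  rw [mem_rootsAt, mem_finiteRoots, form_theta_left, Finset.mem_map]
  simp only [List.mem_toFinset, Function.Embedding.coeFn_mk]
  constructor
  · rintro ⟨⟨h1, h⟩, h2⟩
    have h2 : α a2 = 1 := by omega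
    have h0 : 0 ≤ α := by
      refine (nonneg_or_nonpos_of_form_self h1 h).resolve_right fun hc => ?_
      have := hc a2
      simp at this; omega
    obtain ⟨c, hc, he⟩ := mem_thetaList h0 h1 h2 h
    exact ⟨c, hc, he.symm⟩
  · rintro ⟨⟨p, q, r, s, t, u, v⟩, hc, rfl⟩
    have := form_toRoot_of_mem _ hc
    refine ⟨⟨rfl, ?_⟩, rfl⟩
    rw [← this, form_eq]
    simp only [toRoot]
    ring

theorem form_toRoot (x : RootLattice) (h : x a1 = 0) (p q r s t u v : ℤ) :
    form x (toRoot (p, q, r, s, t, u, v)) =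
      (2 - p) * x a2 + (2 * p - 1 - q) * x a3 + (2 * q - p - r) * x a4
      + (2 * r - q - s) * x a5 + (2 * s - r - t - u) * x a6 + (2 * t - s - v) * x b4
      + (2 * u - s) * x b3 + (2 * v - t) * x b2 := by
  simp only [form_eq, toRoot, h]
  ring

theorem sum_rootsAt_theta (x : RootLattice) (f : ℤ → ℤ) :
    ∑ α ∈ rootsAt theta, f (form x α) = (thetaList.map fun c => f (form x (toRoot c))).sum := by
  rw [rootsAt_theta, Finset.sum_map, List.sum_toFinset _ nodup_thetaList]
  rfl

theorem form_sub_smul_mark (x y : RootLattice) (m : ℤ) : form (x - m • mark) y = form x y := by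
  rw [form_sub_left, form_smul_left, form_mark_left]; ring

set_option maxHeartbeats 4000000 in
set_option maxRecDepth 10000 in
theorem hasMoments_theta_aux {x : RootLattice} (h : x a1 = 0) :
    ∑ α ∈ rootsAt theta, form x α = 28 * form x theta ∧
    ∑ α ∈ rootsAt theta, form x α ^ 2 = 12 * form x x + 8 * form x theta ^ 2 ∧
    ∑ α ∈ rootsAt theta, form x α ^ 3 = 18 * form x theta * form x x - 2 * form x theta ^ 3 ∧
    ∑ α ∈ rootsAt theta, form x α ^ 4 =
      6 * form x x ^ 2 + 12 * form x theta ^ 2 * form x x - 4 * form x theta ^ 4 := by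
  have s1 := sum_rootsAt_theta x (fun t => t)
  have s2 := sum_rootsAt_theta x (fun t => t ^ 2)
  have s3 := sum_rootsAt_theta x (fun t => t ^ 3)
  have s4 := sum_rootsAt_theta x (fun t => t ^ 4)
  rw [s1, s2, s3, s4, form_comm x theta, form_theta_left, form_eq x x, h]
  simp only [thetaList, List.map_cons, List.map_nil, List.sum_cons, List.sum_nil,
    form_toRoot x h]
  generalize x a2 = A
  generalize x a3 = B
  generalize x a4 = C
  generalize x a5 = D
  generalize x a6 = E
  generalize x b4 = F
  generalize x b3 = G
  generalize x b2 = H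
  norm_num only
  refine ⟨?_, ?_, ?_, ?_⟩
  · ring
  · ring
  · ring
  · ring

theorem hasMoments_theta : HasMoments theta := by
  intro x
  refine ⟨?_, ?_⟩
  · rw [rootsAt_theta, Finset.card_map, List.toFinset_card_of_nodup nodup_thetaList]; rfl
  · have := hasMoments_theta_aux (x := x - x a1 • mark) (by simp [mark])
    simpa only [form_sub_smul_mark, form_comm _ (x - x a1 • mark)] using this

theorem hasMoments {γ : RootLattice} (hγ : γ ∈ finiteRoots) : HasMoments γ :=
  hasMoments_of_theta hasMoments_theta hγ

/-- The positive roots of `E₈` as a finite set. -/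
noncomputable def positiveRoots : Finset RootLattice := by
  classical exact finiteRoots.filter fun v => 0 ≤ v

theorem mem_positiveRoots {v : RootLattice} : v ∈ positiveRoots ↔ v ∈ finiteRoots ∧ 0 ≤ v := by
  classical
  simp [positiveRoots]

theorem finsum_posRoots (f : RootLattice → ℚ) :
    ∑ᶠ α ∈ posRoots, f α = ∑ α ∈ positiveRoots, f α := by
  have : posRoots = ↑positiveRoots := by
    ext v
    rw [mem_posRoots, Finset.mem_coe, mem_positiveRoots]
  rw [this, finsum_mem_coe_finset]

theorem ne_zero_of_mem {v : RootLattice} (h : v ∈ finiteRoots) : v ≠ 0 := by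
  rintro rfl
  have := (mem_finiteRoots.1 h).2
  rw [form_zero_left] at this
  omega

theorem sum_finiteRoots_eq_two_mul {f : RootLattice → ℤ} (hf : ∀ α, f (-α) = f α) :
    ∑ α ∈ finiteRoots, f α = 2 * ∑ α ∈ positiveRoots, f α := by
  classical
  rw [← Finset.sum_filter_add_sum_filter_not finiteRoots (fun v => 0 ≤ v), two_mul]
  have e : finiteRoots.filter (fun v => 0 ≤ v) = positiveRoots := by
    ext v; rw [Finset.mem_filter, mem_positiveRoots]
  rw [e]
  refine congrArg₂ (· + ·) rfl ?_
  refine Finset.sum_nbij' (fun v => -v) (fun v => -v) ?_ ?_ (fun _ _ => neg_neg _)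
    (fun _ _ => neg_neg _) (fun v _ => (hf v).symm)
  · intro v hv
    rw [Finset.mem_filter] at hv
    rw [mem_positiveRoots]
    exact ⟨neg_mem_finiteRoots hv.1,
      neg_nonneg.2 ((nonneg_or_nonpos_of_mem hv.1).resolve_left hv.2)⟩
  · intro v hv
    rw [mem_positiveRoots] at hv
    rw [Finset.mem_filter]
    exact ⟨neg_mem_finiteRoots hv.1,
      fun h => ne_zero_of_mem hv.1 (le_antisymm (neg_nonneg.1 h) hv.2)⟩

theorem form_le_one_of_ne {α β : RootLattice} (hα : α ∈ finiteRoots) (hβ : β ∈ finiteRoots)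
    (h : α ≠ β) : form β α ≤ 1 := by
  rw [mem_finiteRoots] at hα hβ
  have h1 : form (β - α) (β - α) = 4 - 2 * form β α := by
    rw [form_sub_left, form_sub_right, form_sub_right, hα.2, hβ.2, form_comm α β]; ring
  have h2 := two_le_form_self (y := β - α) (j := a1) (by simp [hα.1, hβ.1])
    (sub_ne_zero.2 h.symm)
  omega

/-- A sum over the roots of an even function supported on the roots not orthogonal to `β`. -/
theorem sum_finiteRoots_eq_rootsAt {β : RootLattice} (hβ : β ∈ finiteRoots)
    {f : RootLattice → ℤ} (hf : ∀ α, f (-α) = f α) (h0 : ∀ α, form β α = 0 → f α = 0) :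
    ∑ α ∈ finiteRoots, f α = 2 * (f β + ∑ α ∈ rootsAt β, f α) := by
  classical
  have hββ := (mem_finiteRoots.1 hβ).2
  have hpos : finiteRoots.filter (fun α => 0 < form β α) = insert β (rootsAt β) := by
    ext α
    rw [Finset.mem_filter, Finset.mem_insert, mem_rootsAt]
    constructor
    · rintro ⟨h1, h2⟩
      by_cases h : α = β
      · exact Or.inl h
      · have := form_le_one_of_ne h1 hβ h
        exact Or.inr ⟨h1, by omega⟩
    · rintro (rfl | ⟨h1, h2⟩)
      · exact ⟨hβ, by omega⟩
      · exact ⟨h1, by omega⟩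
  have hnot : β ∉ rootsAt β := fun h => by
    have := (mem_rootsAt.1 h).2; omega
  rw [← Finset.sum_filter_add_sum_filter_not finiteRoots (fun α => 0 < form β α),
    ← Finset.sum_filter_add_sum_filter_not
      (finiteRoots.filter fun α => ¬ 0 < form β α) (fun α => form β α = 0),
    Finset.sum_eq_zero (s := Finset.filter (fun α => form β α = 0) _)
      (fun α hα => h0 α (Finset.mem_filter.1 hα).2), zero_add, two_mul,
    ← Finset.sum_insert hnot, ← hpos]
  refine congrArg₂ (· + ·) rfl ?_
  refine Finset.sum_nbij' (fun v => -v) (fun v => -v) ?_ ?_ (fun _ _ => neg_neg _)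
    (fun _ _ => neg_neg _) (fun v _ => (hf v).symm)
  · intro v hv
    simp only [Finset.mem_filter] at hv ⊢
    refine ⟨neg_mem_finiteRoots hv.1.1, ?_⟩
    rw [form_neg_right]; omega
  · intro v hv
    simp only [Finset.mem_filter] at hv ⊢
    refine ⟨⟨neg_mem_finiteRoots hv.1, ?_⟩, ?_⟩ <;> rw [form_neg_right] <;> omega

theorem card_rootsAt {β : RootLattice} (hβ : β ∈ finiteRoots) : (rootsAt β).card = 56 :=
  (hasMoments hβ 0).1

theorem height_eq (x : RootLattice) :
    height x = (1 / 2 : ℚ) * ∑ α ∈ positiveRoots, (form x α : ℚ) := by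
  rw [height, finsum_posRoots]

theorem height_add (x y : RootLattice) : height (x + y) = height x + height y := by
  simp only [height_eq, form_add_left, Int.cast_add, Finset.sum_add_distrib, mul_add]

theorem abs_height_le {β : RootLattice} (hβ : β ∈ finiteRoots) : |height β| ≤ 29 := by
  have h1 := sum_finiteRoots_eq_two_mul (f := fun α => |form β α|)
    (fun α => by rw [form_neg_right, abs_neg])
  have h2 := sum_finiteRoots_eq_rootsAt hβ (f := fun α => |form β α|)
    (fun α => by rw [form_neg_right, abs_neg]) (fun α h => by rw [h, abs_zero])
  have h3 : ∑ α ∈ rootsAt β, |form β α| = 56 := by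
    rw [Finset.sum_congr rfl fun α hα => by rw [(mem_rootsAt.1 hα).2], Finset.sum_const,
      card_rootsAt hβ]
    norm_num
  rw [h3, (mem_finiteRoots.1 hβ).2] at h2
  have h4 : ∑ α ∈ positiveRoots, |form β α| = 58 := by
    norm_num at h2; omega
  have h5 : |∑ α ∈ positiveRoots, (form β α : ℚ)| ≤ 58 := by
    refine (Finset.abs_sum_le_sum_abs _ _).trans ?_
    exact_mod_cast h4.le
  rw [height_eq, abs_mul, abs_of_pos (by norm_num : (0 : ℚ) < 1 / 2)]
  linarith

/-- The polynomial through which the root pairings enter the anomaly. -/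
def quintic (t : ℤ) : ℤ := 96 * t ^ 5 - 400 * t ^ 3

/-- The sum of `quintic` over the absolute values of all root pairings. -/
noncomputable def quinticSum (x : RootLattice) : ℤ := ∑ α ∈ finiteRoots, quintic |form x α|

theorem quinticSum_add (x : RootLattice) {β : RootLattice} (hβ : β ∈ finiteRoots) :
    quinticSum (x + β) - quinticSum x = 2 * (quintic |form x β + 2| - quintic |form x β| +
      ∑ α ∈ rootsAt β, (quintic |form x α + 1| - quintic |form x α|)) := by
  have e : ∀ α ∈ rootsAt β, quintic |form (x + β) α| - quintic |form x α| =
      quintic |form x α + 1| - quintic |form x α| := fun α hα => by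
    rw [form_add_left, (mem_rootsAt.1 hα).2]
  rw [quinticSum, quinticSum, ← Finset.sum_sub_distrib, sum_finiteRoots_eq_rootsAt hβ
    (fun α => by rw [form_neg_right, form_neg_right, abs_neg, abs_neg])
    (fun α h => by rw [form_add_left, h, add_zero, sub_self]), Finset.sum_congr rfl e,
    form_add_left, (mem_finiteRoots.1 hβ).2]

theorem pair_of_apply_eq_zero {l : Coweight} {α : RootLattice} (h : α a1 = 0) :
    pair l α = form l.2 α := by
  rw [pair, h, mul_zero, zero_add]

theorem form_bar_left (l : Coweight) (x : RootLattice) : form (bar l) x = form l.2 x :=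
  form_sub_smul_mark _ _ _

theorem form_nonneg_of_dominant {l : Coweight} (hl : Dominant l) {α : RootLattice}
    (h1 : α a1 = 0) (h0 : 0 ≤ α) : 0 ≤ form l.2 α := by
  rw [form_eq_sum]
  refine Finset.sum_nonneg fun j _ => ?_
  by_cases hj : j = a1
  · rw [hj, h1, zero_mul]
  · have h := hl j
    rw [kac, pair_of_apply_eq_zero (by simp [simple_apply, Ne.symm hj])] at h
    exact mul_nonneg (h0 j) h

theorem anomaly_eq {l : Coweight} (hl : Dominant l) :
    anomaly l = anomalyPoly (level l) (central l) (height (bar l)) (form (bar l) (bar l)) 0 0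
      - quinticSum l.2 / 840 := by
  have h : (quinticSum l.2 : ℚ) = 2 * (96 * ∑ α ∈ positiveRoots, (form (bar l) α : ℚ) ^ 5
      - 400 * ∑ α ∈ positiveRoots, (pair l α : ℚ) ^ 3) := by
    rw [quinticSum, sum_finiteRoots_eq_two_mul (fun α => by rw [form_neg_right, abs_neg]),
      Finset.mul_sum (a := 96), Finset.mul_sum (a := 400), ← Finset.sum_sub_distrib]
    push_cast
    refine congrArg (fun t => 2 * t) (Finset.sum_congr rfl fun α hα => ?_)
    rw [mem_positiveRoots, mem_finiteRoots] at hα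
    rw [form_bar_left, pair_of_apply_eq_zero hα.1.1, quintic,
      abs_of_nonneg (form_nonneg_of_dominant hl hα.1.1 hα.2)]
    push_cast
    ring
  rw [anomaly, finsum_posRoots, finsum_posRoots, h]
  simp only [anomalyPoly]
  ring

theorem sum_rootsAt_comp_sub {β : RootLattice} (hβ : β ∈ finiteRoots) (x : RootLattice)
    (f : ℤ → ℤ) : ∑ α ∈ rootsAt β, f (form x β - form x α) = ∑ α ∈ rootsAt β, f (form x α) := by
  refine Finset.sum_nbij' (fun α => β - α) (fun α => β - α) (fun α hα => sub_mem_rootsAt hβ hα)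
    (fun α hα => sub_mem_rootsAt hβ hα) (fun α _ => sub_sub_cancel _ _)
    (fun α _ => sub_sub_cancel _ _) (fun α _ => ?_)
  rw [form_sub_right]

theorem quintic_pair_aux {b z : ℤ} (hb : 0 ≤ b) (hz : 0 ≤ z) :
    quintic (b + 1) - quintic b - 304 ≤ quintic |b + z + 1| - quintic |b + z| +
      (quintic |-z + 1| - quintic |-z|) := by
  rw [abs_of_nonneg (by omega : 0 ≤ b + z + 1), abs_of_nonneg (by omega : 0 ≤ b + z), abs_neg,
    abs_of_nonneg hz]
  rcases hz.eq_or_lt with rfl | hz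
  · norm_num [quintic]
  · obtain ⟨w, rfl⟩ : ∃ w, z = w + 1 := ⟨z - 1, by ring⟩
    have hw : 0 ≤ w := by omega
    rw [show -(w + 1) + 1 = -w by ring, abs_neg, abs_of_nonneg hw, ← sub_nonneg]
    simp only [quintic]
    ring_nf
    positivity

theorem quintic_pair {b t : ℤ} (hb : 0 ≤ b) (ht : b ≤ t ∨ t ≤ 0) :
    quintic (b + 1) - quintic b - 304 ≤ quintic |t + 1| - quintic |t| +
      (quintic |b - t + 1| - quintic |b - t|) := by
  rcases ht with ht | ht
  · have := quintic_pair_aux hb (sub_nonneg.2 ht)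
    rwa [add_sub_cancel, neg_sub] at this
  · have := quintic_pair_aux hb (neg_nonneg.2 ht)
    rw [neg_neg, ← sub_eq_add_neg] at this
    linarith

theorem sum_quintic_ge {β : RootLattice} (hβ : β ∈ finiteRoots) {x : RootLattice}
    (hb : 0 ≤ form x β) (h : ∀ α ∈ rootsAt β, form x β ≤ form x α ∨ form x α ≤ 0) :
    28 * (quintic (form x β + 1) - quintic (form x β) - 304) ≤
      ∑ α ∈ rootsAt β, (quintic |form x α + 1| - quintic |form x α|) := by
  have h1 := sum_rootsAt_comp_sub hβ x (fun t => quintic |t + 1| - quintic |t|)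
  have h2 := Finset.sum_le_sum fun α hα => quintic_pair hb (h α hα)
  rw [Finset.sum_add_distrib, h1, Finset.sum_const, card_rootsAt hβ, nsmul_eq_mul] at h2
  push_cast at h2
  linarith

theorem quintic_pair' {s t : ℤ} (hs : 2 ≤ s) (h0 : 0 ≤ t) (ht : t ≤ s) :
    quintic (t - 1) - quintic t + (quintic (s - t - 1) - quintic (s - t)) - 608 ≤
      quintic |t - 1| - quintic |t| + (quintic |s - t - 1| - quintic |s - t|) := by
  rw [abs_of_nonneg h0, abs_of_nonneg (sub_nonneg.2 ht)]
  rcases h0.eq_or_lt with rfl | h0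
  · rw [abs_of_nonneg (by omega : 0 ≤ s - 0 - 1)]
    norm_num [quintic]
    linarith
  · rw [abs_of_nonneg (by omega : 0 ≤ t - 1)]
    rcases ht.eq_or_lt with rfl | ht
    · norm_num [quintic]
      linarith
    · rw [abs_of_nonneg (by omega : 0 ≤ s - t - 1)]
      omega

theorem sum_quintic_ge' {γ : RootLattice} (hγ : γ ∈ finiteRoots) {x : RootLattice}
    (hs : 2 ≤ form x γ) (h : ∀ α ∈ rootsAt γ, 0 ≤ form x α) :
    -480 * (6 * form x x ^ 2 + 12 * form x γ ^ 2 * form x x - 4 * form x γ ^ 4)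
      + 960 * (18 * form x γ * form x x - 2 * form x γ ^ 3)
      + 240 * (12 * form x x + 8 * form x γ ^ 2) - 720 * (28 * form x γ) + 304 * 56 - 608 * 28 ≤
      ∑ α ∈ rootsAt γ, (quintic |form x α - 1| - quintic |form x α|) := by
  have h1 := sum_rootsAt_comp_sub hγ x (fun t => quintic |t - 1| - quintic |t|)
  have h1' := sum_rootsAt_comp_sub hγ x (fun t => quintic (t - 1) - quintic t)
  have h2 := Finset.sum_le_sum fun α hα => quintic_pair' hs (h α hα) (by
    have := h _ (sub_mem_rootsAt hγ hα)
    rw [form_sub_right] at this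
    omega)
  obtain ⟨m0, m1, m2, m3, m4⟩ := hasMoments hγ x
  rw [Finset.sum_sub_distrib (g := fun _ => (608 : ℤ)), Finset.sum_add_distrib, h1',
    Finset.sum_add_distrib, h1, Finset.sum_const, card_rootsAt hγ, nsmul_eq_mul] at h2
  have h3 : ∑ α ∈ rootsAt γ, (quintic (form x α - 1) - quintic (form x α)) =
      ∑ α ∈ rootsAt γ, (-480 * form x α ^ 4 + 960 * form x α ^ 3 + 240 * form x α ^ 2
        - 720 * form x α + 304) :=
    Finset.sum_congr rfl fun α _ => by simp only [quintic]; ring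
  have h4 : ∑ α ∈ rootsAt γ, (-480 * form x α ^ 4 + 960 * form x α ^ 3 + 240 * form x α ^ 2
        - 720 * form x α + 304) =
      -480 * (6 * form x x ^ 2 + 12 * form x γ ^ 2 * form x x - 4 * form x γ ^ 4)
      + 960 * (18 * form x γ * form x x - 2 * form x γ ^ 3)
      + 240 * (12 * form x x + 8 * form x γ ^ 2) - 720 * (28 * form x γ) + 304 * 56 := by
    rw [Finset.sum_add_distrib, Finset.sum_sub_distrib, Finset.sum_add_distrib,
      Finset.sum_add_distrib, ← Finset.mul_sum, ← Finset.mul_sum, ← Finset.mul_sum,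
      ← Finset.mul_sum, m1, m2, m3, m4, Finset.sum_const, m0, nsmul_eq_mul]
    norm_num
  push_cast at h2
  linarith

theorem level_eq (l : Coweight) : level l = kac l a1 + 2 * kac l a2 + 3 * kac l a3 + 4 * kac l a4
    + 5 * kac l a5 + 6 * kac l a6 + 4 * kac l b4 + 3 * kac l b3 + 2 * kac l b2 := by
  simp only [level, kac, pair, form_mark_right, form_simple_right, mark, simple_apply]
  simp
  ring

theorem admissible_bound {l : Coweight} (ha : Admissible l) :
    2 * kac l a2 + 4 * kac l a3 + 6 * kac l a4 + 8 * kac l a5 + 10 * kac l a6 + 7 * kac l b4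
      + 5 * kac l b3 + 4 * kac l b2 ≤ 2 * -central l := by
  have h1 := Int.floor_le (((kac l b3 + kac l b4 : ℤ) : ℚ) / 2)
  rw [le_div_iff₀ (by norm_num)] at h1
  have h2 : ⌊((kac l b3 + kac l b4 : ℤ) : ℚ) / 2⌋ * 2 ≤ kac l b3 + kac l b4 := by
    exact_mod_cast h1
  have h3 := min_le_left (⌊((kac l b3 + kac l b4 : ℤ) : ℚ) / 2⌋)
    (⌊((kac l b2 + kac l b3 + 2 * kac l b4 : ℤ) : ℚ) / 3⌋)
  have h4 := level_eq l
  rw [Admissible, fracInst] at ha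
  omega

theorem form_bar_self (l : Coweight) : form (bar l) (bar l) =
    kac l a2 * (2 * kac l a2 + 3 * kac l a3 + 4 * kac l a4 + 5 * kac l a5 + 6 * kac l a6
      + 4 * kac l b4 + 3 * kac l b3 + 2 * kac l b2)
    + kac l a3 * (3 * kac l a2 + 6 * kac l a3 + 8 * kac l a4 + 10 * kac l a5 + 12 * kac l a6
      + 8 * kac l b4 + 6 * kac l b3 + 4 * kac l b2)
    + kac l a4 * (4 * kac l a2 + 8 * kac l a3 + 12 * kac l a4 + 15 * kac l a5 + 18 * kac l a6
      + 12 * kac l b4 + 9 * kac l b3 + 6 * kac l b2)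
    + kac l a5 * (5 * kac l a2 + 10 * kac l a3 + 15 * kac l a4 + 20 * kac l a5 + 24 * kac l a6
      + 16 * kac l b4 + 12 * kac l b3 + 8 * kac l b2)
    + kac l a6 * (6 * kac l a2 + 12 * kac l a3 + 18 * kac l a4 + 24 * kac l a5 + 30 * kac l a6
      + 20 * kac l b4 + 15 * kac l b3 + 10 * kac l b2)
    + kac l b4 * (4 * kac l a2 + 8 * kac l a3 + 12 * kac l a4 + 16 * kac l a5 + 20 * kac l a6
      + 14 * kac l b4 + 10 * kac l b3 + 7 * kac l b2)
    + kac l b3 * (3 * kac l a2 + 6 * kac l a3 + 9 * kac l a4 + 12 * kac l a5 + 15 * kac l a6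
      + 10 * kac l b4 + 8 * kac l b3 + 5 * kac l b2)
    + kac l b2 * (2 * kac l a2 + 4 * kac l a3 + 6 * kac l a4 + 8 * kac l a5 + 10 * kac l a6
      + 7 * kac l b4 + 5 * kac l b3 + 4 * kac l b2) := by
  have h1 : bar l a1 = 0 := by simp [bar, central, mark]
  have h : ∀ i, i ≠ a1 → kac l i = form (bar l) (simple i) := fun i hi => by
    rw [form_bar_left, kac, pair_of_apply_eq_zero (by simp [simple_apply, hi.symm])]
  rw [h a2 nofun, h a3 nofun, h a4 nofun, h a5 nofun, h a6 nofun, h b4 nofun, h b3 nofun,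
    h b2 nofun]
  simp only [form_simple_right, form_eq (bar l) (bar l), h1]
  ring

/-- The bounds on an admissible dominant coweight that control its anomaly. -/
theorem admissible_bounds {l : Coweight} (hl : Dominant l) (ha : Admissible l) {s : ℤ}
    (hs : s = level l - kac l a1) :
    0 ≤ s ∧ s ≤ 2 * -central l ∧ form (bar l) (bar l) ≤ s ^ 2 ∧
      8 * form (bar l) (bar l) ≤ 8 * (s * -central l) + s ^ 2 := by
  have hA := admissible_bound ha
  have hs' : s = 2 * kac l a2 + 3 * kac l a3 + 4 * kac l a4
    + 5 * kac l a5 + 6 * kac l a6 + 4 * kac l b4 + 3 * kac l b3 + 2 * kac l b2 := by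
    rw [hs, level_eq]; ring
  have hL := form_bar_self l
  generalize form (bar l) (bar l) = L at *
  generalize -central l = N at *
  have p2 := hl a2
  have p3 := hl a3
  have p4 := hl a4
  have p5 := hl a5
  have p6 := hl a6
  have q4 := hl b4
  have q3 := hl b3
  have q2 := hl b2
  generalize kac l a2 = n2 at *
  generalize kac l a3 = n3 at *
  generalize kac l a4 = n4 at *
  generalize kac l a5 = n5 at *
  generalize kac l a6 = n6 at *
  generalize kac l b4 = m4 at *
  generalize kac l b3 = m3 at *
  generalize kac l b2 = m2 at *
  have hs0 : 0 ≤ s := by omega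
  refine ⟨hs0, by omega, ?_, ?_⟩
  · rw [hL, hs', ← sub_nonneg]
    ring_nf
    positivity
  · have h1 := mul_le_mul_of_nonneg_left hA hs0
    have h2 : 8 * L ≤ 4 * (s * (2 * n2 + 4 * n3 + 6 * n4 + 8 * n5 + 10 * n6 + 7 * m4 + 5 * m3
        + 4 * m2)) + s ^ 2 := by
      rw [hL, hs', ← sub_nonneg]
      ring_nf
      positivity
    linarith

theorem anomaly_bound_finite {k N L b : ℚ} (hk : 2 ≤ k) (hN : 0 ≤ N) (hb : b = 0 ∨ b = 1 ∨ 2 ≤ b)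
    (hbk : 2 * b ≤ k) (hL : L ≤ k ^ 2) (hL' : 8 * L ≤ 8 * (k * N) + k ^ 2) :
    0 < (b + 1) * (2 * k ^ 3 + 6 * k * N ^ 2 + 6 * k ^ 2 * N - 6 * (L + b) * (k + N) + 9 * N
      + 7 * k) + (15 / 2 * b ^ 4 + 16 * b ^ 3 - 3 / 4 * b ^ 2 - 9 * b - 134 / 15)
      - 1827 / 192 := by
  have hb0 : 0 ≤ b := by rcases hb with h | h | h <;> linarith
  have hk0 : 0 < k := by linarith
  have key : ∀ c, 0 ≤ c → 2 * c ≤ k → 19 / 32 * k ^ 3 - 45 / 4 * c * k + 119 / 8 * k ≤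
      2 * k ^ 3 + 6 * k * N ^ 2 + 6 * k ^ 2 * N - 6 * (L + c) * (k + N) + 9 * N + 7 * k ∨
      5 / 4 * k ^ 3 - 6 * c * k + 7 * k ≤
      2 * k ^ 3 + 6 * k * N ^ 2 + 6 * k ^ 2 * N - 6 * (L + c) * (k + N) + 9 * N + 7 * k := by
    intro c hc hck
    rcases le_total N (7 / 8 * k) with h | h
    · have h1 : 0 ≤ (k + N) * (8 * (k * N) + k ^ 2 - 8 * L) :=
        mul_nonneg (by linarith) (by linarith)
      rcases le_total 0 (9 - 3 / 4 * k ^ 2 - 6 * c) with h2 | h2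
      · have h3 := mul_nonneg hN h2
        right
        linarith
      · have h3 := mul_nonneg (sub_nonneg.2 h) (neg_nonneg.2 h2)
        left
        linarith
    · have h1 : 0 ≤ (k + N) * (k ^ 2 - L) := mul_nonneg (by linarith) (by linarith)
      have h2 : 0 ≤ (N - 7 / 8 * k) * (6 * k * (N + 7 / 8 * k) - 6 * c + 9) :=
        mul_nonneg (by linarith) (by nlinarith)
      left
      linarith
  have hk2 : 0 ≤ k * (k - 2) := mul_nonneg hk0.le (by linarith)
  have hk3 : 0 ≤ k ^ 2 * (k - 2) := mul_nonneg (by positivity) (by linarith)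
  have hkey := key b hb0 hbk
  generalize 2 * k ^ 3 + 6 * k * N ^ 2 + 6 * k ^ 2 * N - 6 * (L + b) * (k + N) + 9 * N + 7 * k = V
    at hkey ⊢
  rcases hb with rfl | rfl | hb
  · rcases hkey with h | h <;> linarith
  · rcases hkey with h | h <;> linarith
  · have hV : 0 ≤ V := by
      have h1 : 0 ≤ k * (k - 2 * b) := mul_nonneg hk0.le (by linarith)
      rcases hkey with h | h
      · have h2 : 0 ≤ k * (k - 90 / 19) ^ 2 := by positivity
        linarith
      · have h2 : 0 ≤ k * (k - 6 / 5) ^ 2 := by positivity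
        linarith
    have h1 : 0 ≤ (b + 1) * V := by positivity
    have h2 : 0 ≤ b ^ 3 * (b - 2) := mul_nonneg (by positivity) (by linarith)
    have h3 : 0 ≤ b ^ 2 * (b - 2) := mul_nonneg (by positivity) (by linarith)
    have h4 : 0 ≤ b * (b - 2) := mul_nonneg hb0 (by linarith)
    linarith

theorem anomaly_bound_affine {s b N L : ℚ} (hs : 2 ≤ s) (hb : 0 ≤ b) (hN : s ≤ 2 * N)
    (hL : L ≤ s ^ 2) :
    0 < 6 * N ^ 2 * b ^ 2 + 6 * N ^ 2 * b * s + 6 * N * b ^ 3 + 12 * N * b ^ 2 * s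
      + 6 * N * b * s ^ 2 + 3 / 2 * b ^ 4 + 4 * b ^ 3 * s + 3 * b ^ 2 * s ^ 2 - 6 * L * N * b
      - 3 * L * b ^ 2 + 6 * N ^ 2 * b + 6 * N ^ 2 * s + 12 * N * b * s + 6 * N * s ^ 2 - b ^ 3
      + 3 * b ^ 2 * s + 3 * b * s ^ 2 - 6 * L * N - 3 * L * b + 3 * N * b + 11 / 4 * b ^ 2
      - 3 / 2 * b * s + 9 * N + 11 / 2 * b - 1 / 2 * s + 4693 / 480 - 17024 / 1920
      - 1827 / 192 := by
  have hN0 : 1 ≤ N := by linarith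
  have h1 : 0 ≤ (6 * N * b + 3 * b ^ 2 + 6 * N + 3 * b) * (s ^ 2 - L) :=
    mul_nonneg (by positivity) (by linarith)
  have h2 : 0 ≤ b ^ 3 * (s - 2) := mul_nonneg (by positivity) (by linarith)
  have h3 : 0 ≤ b * s * (N - 1) := mul_nonneg (by positivity) (by linarith)
  have h4 : 2 * 1 ^ 2 ≤ s * N ^ 2 :=
    mul_le_mul hs (pow_le_pow_left₀ zero_le_one hN0 2) (by norm_num) (by linarith)
  have h5 : 0 ≤ N ^ 2 * b ^ 2 := by positivity
  have h6 : 0 ≤ N ^ 2 * b * s := by positivity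
  have h7 : 0 ≤ N * b ^ 3 := by positivity
  have h8 : 0 ≤ N * b ^ 2 * s := by positivity
  have h9 : 0 ≤ b ^ 4 := by positivity
  have h10 : 0 ≤ N ^ 2 * b := by positivity
  have h11 : 0 ≤ b ^ 2 * s := by positivity
  have h12 : 0 ≤ N * b := by positivity
  have h13 : 0 ≤ b ^ 3 := by positivity
  have h14 : 0 ≤ b * s := by positivity
  have h15 : 0 ≤ b ^ 2 := by positivity
  nlinarith

theorem level_add_ofCoroot (l : Coweight) (β : RootLattice) :
    level (l + ofCoroot β) = level l := by
  simp [level, pair, ofCoroot, form_mark_right]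

theorem central_add_ofCoroot (l : Coweight) (β : RootLattice) :
    central (l + ofCoroot β) = central l + β a1 := rfl

theorem bar_add_ofCoroot (l : Coweight) (β : RootLattice) :
    bar (l + ofCoroot β) = bar l + (β - β a1 • mark) := by
  simp only [bar, central_add_ofCoroot]
  simp only [ofCoroot, Prod.snd_add]
  module

theorem pair_add_ofCoroot (l : Coweight) (β α : RootLattice) :
    pair (l + ofCoroot β) α = pair l α + form β α := by
  simp only [pair, ofCoroot, Prod.fst_add, Prod.snd_add, form_add_left, add_zero, add_assoc]

theorem kac_add_ofCoroot (l : Coweight) (β : RootLattice) (i : Node) :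
    kac (l + ofCoroot β) i = kac l i + form β (simple i) := pair_add_ofCoroot _ _ _

theorem quinticSum_sub_smul_mark (x : RootLattice) (m : ℤ) :
    quinticSum (x - m • mark) = quinticSum x := by
  simp only [quinticSum, form_sub_smul_mark]

theorem anomaly_add_finite_lt {l : Coweight} (hl : Dominant l) (hk : 1 < level l)
    (ha : Admissible l) {β : RootLattice} (hβ : β ∈ finiteRoots)
    (hμ : Dominant (l + ofCoroot β)) (hb : 0 ≤ form l.2 β) (hbk : 2 * form l.2 β ≤ level l)
    (hR : ∀ α ∈ rootsAt β, form l.2 β ≤ form l.2 α ∨ form l.2 α ≤ 0) :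
    0 < anomaly l - anomaly (l + ofCoroot β) := by
  obtain ⟨h1, h2⟩ := mem_finiteRoots.1 hβ
  obtain ⟨hs0, hsN, hL, hL'⟩ := admissible_bounds hl ha rfl
  have hkac := hl a1
  have hS := quinticSum_add l.2 hβ
  have hge := sum_quintic_ge hβ hb hR
  rw [abs_of_nonneg hb, abs_of_nonneg (by omega)] at hS
  have hht := (abs_le.1 (abs_height_le hβ)).1
  rw [anomaly_eq hl, anomaly_eq hμ, level_add_ofCoroot, central_add_ofCoroot, bar_add_ofCoroot,
    h1, zero_smul, sub_zero, add_zero, height_add]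
  have hLadd : form (bar l + β) (bar l + β) = form (bar l) (bar l) + 2 * form l.2 β + 2 := by
    rw [form_add_left, form_add_right, form_add_right, form_comm β, form_bar_left l β, h2]; ring
  have hq : (l + ofCoroot β).2 = l.2 + β := rfl
  rw [hLadd, hq]
  generalize form (bar l) (bar l) = L at *
  generalize form l.2 β = b at *
  generalize central l = n at *
  generalize level l = k at *
  have hbd : b = 0 ∨ b = 1 ∨ 2 ≤ b := by omega
  have hLk : L ≤ k ^ 2 := hL.trans (pow_le_pow_left₀ hs0 (by omega) 2)
  have hLk' : 8 * L ≤ 8 * (k * -n) + k ^ 2 := by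
    have e1 : (k - kac l a1) * -n ≤ k * -n := mul_le_mul_of_nonneg_right (by omega) (by omega)
    have e2 : (k - kac l a1) ^ 2 ≤ k ^ 2 := pow_le_pow_left₀ hs0 (by omega) 2
    omega
  have main := anomaly_bound_finite (k := k) (N := -n) (L := L) (b := b)
    (by exact_mod_cast hk) (by exact_mod_cast (by omega : 0 ≤ -n)) (by exact_mod_cast hbd)
    (by exact_mod_cast hbk) (by exact_mod_cast hLk) (by exact_mod_cast hLk')
  have hfin : 2 * (quintic (b + 2) - quintic b + 28 * (quintic (b + 1) - quintic b - 304)) ≤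
      quinticSum (l.2 + β) - quinticSum l.2 := by omega
  have hfin' : ((2 * (quintic (b + 2) - quintic b + 28 * (quintic (b + 1) - quintic b - 304)) : ℤ)
      : ℚ) ≤ ((quinticSum (l.2 + β) - quinticSum l.2 : ℤ) : ℚ) := by exact_mod_cast hfin
  simp only [quintic] at hfin'
  push_cast at hfin' main ⊢
  simp only [anomalyPoly]
  linarith

theorem anomaly_add_affine_lt {l : Coweight} (hl : Dominant l) (ha : Admissible l)
    {γ : RootLattice} (hγ : γ ∈ finiteRoots) (hμ : Dominant (l + ofCoroot (mark - γ)))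
    (hs : form l.2 γ = level l - kac l a1) (hs2 : 2 ≤ form l.2 γ)
    (hR : ∀ α ∈ rootsAt γ, 0 ≤ form l.2 α) :
    0 < anomaly l - anomaly (l + ofCoroot (mark - γ)) := by
  obtain ⟨h1, h2⟩ := mem_finiteRoots.1 hγ
  obtain ⟨hs0, hsN, hL, hL'⟩ := admissible_bounds hl ha hs
  have hkac := hl a1
  have hγ' := neg_mem_finiteRoots hγ
  have hge := sum_quintic_ge' (x := bar l) hγ (by rwa [form_bar_left])
    (fun α hα => by rw [form_bar_left]; exact hR α hα)
  have hS := quinticSum_add (bar l) hγ'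
  have hneg : ∑ α ∈ rootsAt (-γ), (quintic |form (bar l) α + 1| - quintic |form (bar l) α|) =
      ∑ α ∈ rootsAt γ, (quintic |form (bar l) α - 1| - quintic |form (bar l) α|) := by
    refine Finset.sum_nbij' (fun α => -α) (fun α => -α) ?_ ?_ (fun _ _ => neg_neg _)
      (fun _ _ => neg_neg _) ?_
    · intro α hα
      rw [mem_rootsAt] at hα ⊢
      exact ⟨neg_mem_finiteRoots hα.1, by rw [form_neg_right, ← form_neg_left, hα.2]⟩
    · intro α hα
      rw [mem_rootsAt] at hα ⊢
      exact ⟨neg_mem_finiteRoots hα.1, by rw [form_neg_left, form_neg_right, neg_neg, hα.2]⟩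
    · intro α hα
      rw [form_neg_right, abs_neg, ← abs_neg (-form (bar l) α - 1)]
      ring_nf
  rw [hneg, form_neg_right, abs_neg, ← abs_neg (-form (bar l) γ + 2),
    abs_of_nonneg (a := form (bar l) γ) (by rw [form_bar_left]; omega),
    abs_of_nonneg (by rw [form_bar_left]; omega)] at hS
  have hht := (abs_le.1 (abs_height_le hγ')).1
  have hm : (mark - γ) a1 = 1 := by simp [h1, mark]
  have hbarμ : bar (l + ofCoroot (mark - γ)) = bar l + -γ := by
    rw [bar_add_ofCoroot, hm]; module
  have hq : quinticSum (l + ofCoroot (mark - γ)).2 = quinticSum (bar l + -γ) := by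
    rw [← hbarμ, bar, quinticSum_sub_smul_mark]
  have hq0 : quinticSum l.2 = quinticSum (bar l) := by rw [bar, quinticSum_sub_smul_mark]
  rw [anomaly_eq hl, anomaly_eq hμ, level_add_ofCoroot, central_add_ofCoroot, hbarμ, hq, hq0, hm,
    height_add]
  have hLadd : form (bar l + -γ) (bar l + -γ) = form (bar l) (bar l) - 2 * form l.2 γ + 2 := by
    rw [form_add_left, form_add_right, form_add_right, form_comm (-γ), form_neg_right,
      form_neg_right, form_bar_left l γ, form_neg_left, h2]; ring
  rw [hLadd]
  rw [form_bar_left l γ] at hS hge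
  generalize form (bar l) (bar l) = L at *
  obtain ⟨b, hb⟩ : ∃ b, b = kac l a1 := ⟨_, rfl⟩
  rw [← hb] at hkac hs
  have hk : level l = form l.2 γ + b := by omega
  rw [hk]
  generalize form l.2 γ = s at *
  generalize central l = n at *
  have main := anomaly_bound_affine (s := s) (b := b) (N := -n) (L := L)
    (by exact_mod_cast hs2) (by exact_mod_cast hkac) (by exact_mod_cast hsN)
    (by exact_mod_cast hL)
  generalize ∑ α ∈ rootsAt γ, (quintic |form (bar l) α - 1| - quintic |form (bar l) α|) = T at *
  have hfin : ((2 * (quintic (-(-s + 2)) - quintic s +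
      (-480 * (6 * L ^ 2 + 12 * s ^ 2 * L - 4 * s ^ 4)
      + 960 * (18 * s * L - 2 * s ^ 3)
      + 240 * (12 * L + 8 * s ^ 2) - 720 * (28 * s) + 304 * 56 - 608 * 28)) : ℤ)
      : ℚ) ≤ ((quinticSum (bar l + -γ) - quinticSum (bar l) : ℤ) : ℚ) := by
    exact_mod_cast (by omega)
  simp only [quintic] at hfin
  push_cast at hfin main ⊢
  simp only [anomalyPoly]
  linarith

theorem pair_eq_sum (l : Coweight) (α : RootLattice) : pair l α = ∑ j, α j * kac l j := by
  simp only [kac, pair, mul_add, Finset.sum_add_distrib, ← form_eq_sum]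
  congr 1
  rw [sum_node]
  simp [simple_apply]
  ring

theorem form_simple_simple_of_adj {i j : Node} (h : dynkin.Adj i j) :
    form (simple i) (simple j) = -1 := by
  rw [form_simple_simple, cartan, if_neg h.ne, if_pos h]

theorem adj_of_form_simple_simple_neg {i j : Node} (h : form (simple i) (simple j) < 0) :
    dynkin.Adj i j := by
  rw [form_simple_simple, cartan] at h
  by_contra hc
  rw [if_neg hc] at h
  split_ifs at h <;> omega

theorem simple_nonneg (i : Node) : 0 ≤ simple i := fun j => by
  rw [Pi.zero_apply, simple_apply]; split_ifs <;> norm_num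

theorem form_simple_nonpos_of_apply_eq_zero {x : RootLattice} (hx : 0 ≤ x) {j : Node}
    (hj : x j = 0) : form x (simple j) ≤ 0 :=
  form_nonpos_of_disjoint hx (simple_nonneg j) fun i => by
    rw [simple_apply]
    split_ifs with h
    · rw [h, hj, zero_mul]
    · rw [mul_zero]

theorem form_simple_neg_of_adj {x : RootLattice} (hx : 0 ≤ x) {i j : Node}
    (hij : dynkin.Adj i j) (hi : 1 ≤ x i) (hj : x j = 0) : form x (simple j) < 0 := by
  have h := form_simple_nonpos_of_apply_eq_zero (x := x - simple i) (fun a => by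
    have := hx a
    simp only [Pi.zero_apply, Pi.sub_apply, simple_apply] at this ⊢
    split_ifs with ha
    · subst ha; omega
    · omega) (j := j) (by simp [hj, simple_apply, hij.ne'])
  rw [form_sub_left, form_simple_simple_of_adj hij] at h
  omega

theorem level_eq_pair (l : Coweight) : level l = pair l mark := rfl

theorem dominant_add_simple {l : Coweight} (hl : Dominant l) {i : Node}
    (h : ∀ j, dynkin.Adj i j → 0 < kac l j) : Dominant (l + ofCoroot (simple i)) := by
  intro j
  have hj := hl j
  rw [kac_add_ofCoroot]
  by_cases hij : dynkin.Adj i j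
  · have := h j hij
    rw [form_simple_simple_of_adj hij]; omega
  · have : ¬ form (simple i) (simple j) < 0 := fun hc => hij (adj_of_form_simple_simple_neg hc)
    omega

theorem nonneg_of_mem_rootsAt_theta {α : RootLattice} (h : α ∈ rootsAt theta) : 0 ≤ α := by
  obtain ⟨h1, h2⟩ := mem_rootsAt.1 h
  refine (nonneg_or_nonpos_of_mem h1).resolve_right fun hc => ?_
  have := hc a2
  rw [form_theta_left, (mem_finiteRoots.1 h1).1] at h2
  simp at this; omega

theorem anomaly_add_simple_lt {l : Coweight} (hl : Dominant l) (hk : 1 < level l)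
    (ha : Admissible l) {i : Node} (h : ∀ j, dynkin.Adj i j → 0 < kac l j) :
    0 < anomaly l - anomaly (l + ofCoroot (simple i)) := by
  have hμ := dominant_add_simple hl h
  by_cases hi : i = a1
  · subst hi
    have e : simple a1 = mark - theta := by rw [theta]; abel
    have h2 := h a2 (by decide)
    have hs : form l.2 theta = level l - kac l a1 := by
      rw [level_eq_pair, kac, form_comm, form_theta_left, pair, pair, form_mark_right,
        form_simple_right, simple_apply, if_pos rfl, mark]
      ring
    rw [e] at hμ ⊢
    refine anomaly_add_affine_lt hl ha theta_mem_finiteRoots hμ hs ?_ fun α hα => ?_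
    · rw [hs, level_eq]
      have := hl a3
      have := hl a4
      have := hl a5
      have := hl a6
      have := hl b4
      have := hl b3
      have := hl b2
      omega
    · exact form_nonneg_of_dominant hl (mem_finiteRoots.1 (mem_rootsAt.1 hα).1).1
        (nonneg_of_mem_rootsAt_theta hα)
  · have hβ := simple_mem_finiteRoots hi
    have hf : form l.2 (simple i) = kac l i := by
      rw [kac, pair_of_apply_eq_zero (mem_finiteRoots.1 hβ).1]
    refine anomaly_add_finite_lt hl hk ha hβ hμ (by rw [hf]; exact hl i) ?_ fun α hα => ?_
    · rw [hf, level_eq]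
      have := hl a1
      have := hl a2
      have := hl a3
      have := hl a4
      have := hl a5
      have := hl a6
      have := hl b4
      have := hl b3
      have := hl b2
      cases i <;> first | exact absurd rfl hi | omega
    · obtain ⟨h1, h2⟩ := mem_rootsAt.1 hα
      obtain ⟨h3, h4⟩ := mem_finiteRoots.1 h1
      rcases nonneg_or_nonpos_of_mem h1 with h0 | h0
      · left
        have h5 : form (α - simple i) (α - simple i) = 2 :=
          form_self_sub_simple h4 (by rw [form_comm, h2])
        have h6 : (α - simple i) a1 = 0 := by simp [h3, simple_apply, Ne.symm hi]
        rcases nonneg_or_nonpos_of_form_self h6 h5 with h7 | h7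
        · have := form_nonneg_of_dominant hl h6 h7
          rw [form_sub_right] at this
          omega
        · exfalso
          have e : α = α i • simple i := by
            funext j
            have h8 := h7 j
            have h9 := h0 j
            simp only [Pi.zero_apply, Pi.sub_apply, Pi.smul_apply, simple_apply,
              smul_eq_mul] at h8 h9 ⊢
            split_ifs at h8 ⊢ with hj
            · rw [hj, mul_one]
            · omega
          rw [e, form_smul_right, form_simple_self] at h2
          omega
      · right
        have := form_nonneg_of_dominant hl (α := -α) (by simp [h3]) (neg_nonneg.2 h0)
        rw [form_neg_right] at this
        omega

/-- The combinatorial content of being a connected component of the zeros of `l`. -/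
structure ZeroComponent (l : Coweight) (I : Set Node) : Prop where
  kac_eq_zero : ∀ i ∈ I, kac l i = 0
  mem_of_adj : ∀ i ∈ I, ∀ j, dynkin.Adj i j → kac l j = 0 → j ∈ I
  nonempty : I.Nonempty
  subset_of_closed : ∀ S : Set Node, (∃ i ∈ I, i ∈ S) →
    (∀ i ∈ I, i ∈ S → ∀ j ∈ I, dynkin.Adj i j → j ∈ S) → I ⊆ S

theorem IsZeroComponent.zeroComponent {l : Coweight} {I : Set Node} (h : IsZeroComponent l I) :
    ZeroComponent l I := by
  obtain ⟨C, rfl⟩ := h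
  refine ⟨?_, ?_, ?_, ?_⟩
  · rintro _ ⟨⟨i, hi⟩, -, rfl⟩
    exact hi
  · rintro _ ⟨⟨i, hi⟩, hC, rfl⟩ j hij hj
    refine ⟨⟨j, hj⟩, ?_, rfl⟩
    rw [SimpleGraph.ConnectedComponent.mem_supp_iff] at hC ⊢
    rw [← hC, SimpleGraph.ConnectedComponent.eq]
    exact SimpleGraph.Adj.reachable (SimpleGraph.induce_adj.2 hij.symm)
  · exact C.nonempty_supp.image _
  · rintro S ⟨_, ⟨i, hC, rfl⟩, hiS⟩ hS _ ⟨j, hjC, rfl⟩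
    rw [SimpleGraph.ConnectedComponent.mem_supp_iff] at hC hjC
    have hr : (dynkin.induce {i | kac l i = 0}).Reachable i j := by
      rw [← SimpleGraph.ConnectedComponent.eq, hC, hjC]
    obtain ⟨w⟩ := hr
    have : ∀ u v : {i | kac l i = 0}, (dynkin.induce {i | kac l i = 0}).Walk u v →
        u ∈ C.supp → u.1 ∈ S → v.1 ∈ S := by
      intro u v w
      induction w with
      | nil => exact fun _ h => h
      | @cons u v x hadj p ih =>
        intro hu huS
        have hv : v ∈ C.supp := by
          rw [SimpleGraph.ConnectedComponent.mem_supp_iff] at hu ⊢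
          rw [← hu, SimpleGraph.ConnectedComponent.eq]
          exact hadj.symm.reachable
        exact ih hv (hS _ ⟨u, hu, rfl⟩ huS _ ⟨v, hv, rfl⟩ (SimpleGraph.induce_adj.1 hadj))
    exact this i j w (by rwa [SimpleGraph.ConnectedComponent.mem_supp_iff]) hiS

theorem ZeroComponent.exists_notMem {l : Coweight} {I : Set Node} (h : ZeroComponent l I)
    (hk : 1 < level l) : ∃ m, m ∉ I := by
  by_contra! hc
  have : level l = 0 := by
    rw [level_eq_pair, pair_eq_sum]
    exact Finset.sum_eq_zero fun j _ => by rw [h.kac_eq_zero j (hc j), mul_zero]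
  omega

theorem ZeroComponent.pair_eq_zero {l : Coweight} {I : Set Node} (h : ZeroComponent l I)
    {β : RootLattice} (hβ : ∀ j ∉ I, β j = 0) : pair l β = 0 := by
  rw [pair_eq_sum]
  refine Finset.sum_eq_zero fun j _ => ?_
  by_cases hj : j ∈ I
  · rw [h.kac_eq_zero j hj, mul_zero]
  · rw [hβ j hj, zero_mul]

theorem IsHighestRoot.nonneg {I : Set Node} {β : RootLattice} (h : IsHighestRoot I β)
    (hI : I.Nonempty) : 0 ≤ β := by
  obtain ⟨i, hi⟩ := hI
  exact (simple_nonneg i).trans (h.2 (IsRootOf.simple i hi))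

theorem IsHighestRoot.form_simple_nonneg {I : Set Node} {β : RootLattice}
    (h : IsHighestRoot I β) {j : Node} (hj : j ∈ I) : 0 ≤ form β (simple j) := by
  have : (β - form (simple j) β • simple j) j ≤ β j := h.2 (IsRootOf.reflect j hj β h.1) j
  rw [Pi.sub_apply, Pi.smul_apply, simple_apply, if_pos rfl, smul_eq_mul, mul_one,
    form_comm] at this
  omega

theorem dominant_add_highestRoot {l : Coweight} (hl : Dominant l) (hk : 1 < level l)
    {I : Set Node} (hI : ZeroComponent l I) {β : RootLattice} (hβ : IsHighestRoot I β) :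
    Dominant (l + ofCoroot β) := by
  intro j
  have hj := hl j
  rw [kac_add_ofCoroot]
  by_cases hjI : j ∈ I
  · have := hβ.form_simple_nonneg hjI; omega
  have hβ0 := hβ.nonneg hI.nonempty
  have hβj := hβ.1.apply_eq_zero hjI
  have hsum : form (β + simple j) (β + simple j) = 4 + 2 * form β (simple j) := by
    rw [form_add_left, form_add_right, form_add_right, hβ.1.form_self, form_simple_self,
      form_comm (simple j)]; ring
  have h2 := form_self_nonneg (β + simple j)
  rcases lt_trichotomy (form β (simple j)) (-1) with h | h | h
  · have e := eq_smul_mark_of_form_self (y := β + simple j) (by omega)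
    generalize (β + simple j) a1 = t at e
    have ej : 1 = t * mark j := by
      have := congrFun e j
      rwa [Pi.add_apply, hβj, simple_apply, if_pos rfl, zero_add, Pi.smul_apply,
        smul_eq_mul] at this
    have ht : 1 ≤ t := by
      have := mark_pos j
      by_contra hc
      nlinarith
    have hp : pair l (β + simple j) = kac l j := by
      rw [kac, ← zero_add (pair l (simple j)), ← hI.pair_eq_zero
        (fun i hi => hβ.1.apply_eq_zero hi)]
      simp only [pair, Pi.add_apply, form_add_right]; ring
    have hp' : pair l (t • mark) = t * level l := by
      rw [level_eq_pair, pair, pair, form_smul_right, Pi.smul_apply, smul_eq_mul]; ring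
    rw [e, hp'] at hp
    have : level l ≤ t * level l := le_mul_of_one_le_left (by omega) ht
    omega
  · have : kac l j ≠ 0 := fun hc => hjI <| by
      by_contra hjI
      have hneg : ¬ 0 ≤ form β (simple j) := by omega
      rw [form_comm, form_eq_sum] at hneg
      refine hneg (Finset.sum_nonneg fun i _ => ?_)
      by_cases hi : i ∈ I
      · refine mul_nonneg (hβ0 i) (not_lt.1 fun hlt => hjI ?_)
        exact hI.mem_of_adj i hi j (adj_of_form_simple_simple_neg hlt).symm hc
      · rw [hβ.1.apply_eq_zero hi, zero_mul]
    omega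
  · omega

theorem anomaly_add_highestRoot_lt {l : Coweight} (hl : Dominant l) (hk : 1 < level l)
    (ha : Admissible l) {I : Set Node} (hI : ZeroComponent l I) {β : RootLattice}
    (hβ : IsHighestRoot I β) : 0 < anomaly l - anomaly (l + ofCoroot β) := by
  have hμ := dominant_add_highestRoot hl hk hI hβ
  have hpair := hI.pair_eq_zero (fun i hi => hβ.1.apply_eq_zero hi)
  by_cases h1 : β a1 = 0
  · have hf : form l.2 β = 0 := by rw [← pair_of_apply_eq_zero h1, hpair]
    refine anomaly_add_finite_lt hl hk ha (mem_finiteRoots.2 ⟨h1, hβ.1.form_self⟩) hμ hf.ge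
      (by rw [hf]; omega) fun α _ => ?_
    rw [hf]
    exact le_total _ _
  · obtain ⟨m, hm⟩ := hI.exists_notMem hk
    have h1' : 1 ≤ β a1 := by
      have := hβ.nonneg hI.nonempty a1
      simp at this; omega
    have hγ : β a1 • mark - β ∈ finiteRoots := by
      rw [mem_finiteRoots]
      refine ⟨by simp [mark], ?_⟩
      rw [form_sub_left, form_sub_right, form_sub_right, form_smul_left, form_smul_left,
        form_smul_right, form_smul_right, form_mark_left, form_mark_left, form_mark_right,
        hβ.1.form_self]
      ring
    have h1'' : β a1 = 1 := by
      have := (le_mark_of_mem hγ m).2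
      rw [Pi.sub_apply, hβ.1.apply_eq_zero hm, sub_zero, Pi.smul_apply, smul_eq_mul] at this
      have := mark_pos m
      nlinarith
    rw [h1'', one_smul] at hγ
    have hs : form l.2 (mark - β) = level l := by
      rw [← pair_of_apply_eq_zero (mem_finiteRoots.1 hγ).1, level_eq_pair, ← sub_zero (pair l mark),
        ← hpair]
      simp only [pair, Pi.sub_apply, form_sub_right]; ring
    have ha1 : kac l a1 = 0 := by
      refine hI.kac_eq_zero a1 ?_
      by_contra hc
      exact h1 (hβ.1.apply_eq_zero hc)
    have e : β = mark - (mark - β) := by abel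
    rw [e] at hμ ⊢
    refine anomaly_add_affine_lt hl ha hγ hμ (by rw [hs, ha1, sub_zero]) (by omega)
      fun α hα => ?_
    have h3 := (mem_rootsAt.1 (sub_mem_rootsAt hγ hα)).1
    have h4 : form l.2 (mark - β - α) ≤ level l := by
      rw [← pair_of_apply_eq_zero (mem_finiteRoots.1 h3).1, level_eq_pair, pair_eq_sum, pair_eq_sum]
      exact Finset.sum_le_sum fun j _ => mul_le_mul_of_nonneg_right (le_mark_of_mem h3 j).2 (hl j)
    rw [form_sub_right, hs] at h4
    omega

theorem ZeroComponent.pos_of_form_nonneg {l : Coweight} {I : Set Node} (hI : ZeroComponent l I)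
    {y : RootLattice} (h0 : 0 ≤ y) (hd : ∀ j ∈ I, 0 ≤ form y (simple j))
    (hy : ∃ i ∈ I, 1 ≤ y i) : ∀ j ∈ I, 1 ≤ y j := by
  refine fun j hj => hI.subset_of_closed {i | 1 ≤ y i} hy (fun i hi hyi k hk hik => ?_) hj
  by_contra hc
  have h1 := form_simple_neg_of_adj h0 hik hyi (by
    have := h0 k
    simp at this hc; omega)
  have := hd k hk
  omega

theorem ZeroComponent.exists_isHighestRoot {l : Coweight} {I : Set Node}
    (hI : ZeroComponent l I) {m : Node} (hm : m ∉ I) {y : RootLattice}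
    (hy : ∀ γ, IsRootOf I γ → γ ≤ y) : ∃ β, IsHighestRoot I β := by
  obtain ⟨i, hi⟩ := hI.nonempty
  obtain ⟨_, ⟨β, hβ, rfl⟩, hmax⟩ := Int.exists_greatest_of_bdd
    (P := fun n => ∃ β, IsRootOf I β ∧ ∑ i, β i = n)
    ⟨∑ i, y i, by rintro _ ⟨β, hβ, rfl⟩; exact Finset.sum_le_sum fun i _ => hy β hβ i⟩
    ⟨_, simple i, .simple i hi, rfl⟩
  have hd : ∀ j ∈ I, 0 ≤ form β (simple j) := fun j hj => by
    have := hmax _ ⟨_, IsRootOf.reflect j hj β hβ, rfl⟩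
    have e : ∑ i, simple j i = 1 := by simp [simple_apply]
    simp only [Pi.sub_apply, Pi.smul_apply, smul_eq_mul, Finset.sum_sub_distrib,
      ← Finset.mul_sum, e] at this
    rw [form_comm]
    omega
  have hβm := hβ.apply_eq_zero hm
  have h0 : 0 ≤ β := by
    refine (nonneg_or_nonpos_of_form_self hβm hβ.form_self).resolve_right fun hc => ?_
    have h1 : form β β ≤ 0 := by
      rw [form_eq_sum]
      refine Finset.sum_nonpos fun j _ => ?_
      by_cases hj : j ∈ I
      · exact mul_nonpos_of_nonpos_of_nonneg (hc j) (hd j hj)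
      · rw [hβ.apply_eq_zero hj, zero_mul]
    rw [hβ.form_self] at h1
    omega
  have hpos : ∃ i ∈ I, 1 ≤ β i := by
    obtain ⟨j, hj, -⟩ := exists_pos_of_form_pos (x := β) h0 (by rw [hβ.form_self]; norm_num)
    refine ⟨j, ?_, hj⟩
    by_contra hc
    rw [hβ.apply_eq_zero hc] at hj
    omega
  exact ⟨β, hβ, fun γ hγ => root_le_of_dominant hm (hI.pos_of_form_nonneg h0 hd hpos)
    (fun j hj => hβ.apply_eq_zero hj) hd (fun j hj => hγ.apply_eq_zero hj) hγ.form_self⟩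

/-- Between two comparable dominant coweights there is a minimal degeneration of one of the two
types. -/
theorem exists_degeneration {l : Coweight} (hl : Dominant l) (hk : 1 < level l)
    {x : RootLattice} (hx : 0 ≤ x) (hx0 : x ≠ 0) (hm : Dominant (l + ofCoroot x)) :
    ∃ β, 0 ≤ β ∧ β ≠ 0 ∧ β ≤ x ∧ Dominant (l + ofCoroot β) ∧
      (Admissible l → 0 < anomaly l - anomaly (l + ofCoroot β)) := by
  by_cases hz : ∃ i, 1 ≤ x i ∧ kac l i = 0
  · obtain ⟨i, hxi, hi⟩ := hz
    set C := (dynkin.induce {i | kac l i = 0}).connectedComponentMk ⟨i, hi⟩ with hC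
    have hI : ZeroComponent l (Subtype.val '' C.supp) :=
      IsZeroComponent.zeroComponent ⟨C, rfl⟩
    have hiI : i ∈ (Subtype.val '' C.supp : Set Node) :=
      ⟨⟨i, hi⟩, SimpleGraph.ConnectedComponent.connectedComponentMk_mem, rfl⟩
    generalize (Subtype.val '' C.supp : Set Node) = I at hI hiI
    obtain ⟨m, hmI⟩ := hI.exists_notMem hk
    have hdx : ∀ j ∈ I, 0 ≤ form x (simple j) := fun j hj => by
      have := hm j
      rwa [kac_add_ofCoroot, hI.kac_eq_zero j hj, zero_add] at this
    classical
    set y : RootLattice := fun j => if j ∈ I then x j else 0 with hy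
    have hy0 : 0 ≤ y := fun j => by
      simp only [hy, Pi.zero_apply]; split_ifs; exacts [hx j, le_rfl]
    have hyx : y ≤ x := fun j => by
      simp only [hy]; split_ifs; exacts [le_rfl, hx j]
    have hdy : ∀ j ∈ I, 0 ≤ form y (simple j) := fun j hj => by
      have h1 := form_simple_nonpos_of_apply_eq_zero (x := x - y) (sub_nonneg.2 hyx) (j := j)
        (by simp [hy, hj])
      have h2 := hdx j hj
      rw [form_sub_left] at h1
      omega
    have hy1 := hI.pos_of_form_nonneg hy0 hdy ⟨i, hiI, by simpa [hy, hiI] using hxi⟩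
    have hle : ∀ γ, IsRootOf I γ → γ ≤ y := fun γ hγ =>
      root_le_of_dominant hmI hy1 (fun j hj => by simp [hy, hj]) hdy
        (fun j hj => hγ.apply_eq_zero hj) hγ.form_self
    obtain ⟨β, hβ⟩ := hI.exists_isHighestRoot hmI hle
    refine ⟨β, hβ.nonneg hI.nonempty, ?_, (hle β hβ.1).trans hyx,
      dominant_add_highestRoot hl hk hI hβ, fun ha => anomaly_add_highestRoot_lt hl hk ha hI hβ⟩
    rintro rfl
    have := hβ.1.form_self
    rw [form_zero_left] at this
    omega
  · push Not at hz
    obtain ⟨i, hi⟩ : ∃ i, 1 ≤ x i := by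
      by_contra! hc
      refine hx0 (le_antisymm (fun i => ?_) hx)
      have := hc i
      simp only [Pi.zero_apply]; omega
    have hadj : ∀ j, dynkin.Adj i j → 0 < kac l j := fun j hij => by
      have h1 := hl j
      have h2 : (0 : ℤ) ≤ x j := hx j
      by_cases hj : 1 ≤ x j
      · have := hz j hj; omega
      · have h3 := form_simple_neg_of_adj hx hij hi (by omega)
        have h4 := hm j
        rw [kac_add_ofCoroot] at h4
        omega
    refine ⟨simple i, simple_nonneg i, ?_, fun j => ?_, dominant_add_simple hl hadj,
      fun ha => anomaly_add_simple_lt hl hk ha hadj⟩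
    · intro h
      have := congrFun h i
      rw [simple_apply, if_pos rfl] at this
      exact one_ne_zero this
    · rw [simple_apply]
      split_ifs with h
      · rw [h]; exact hi
      · exact hx j

theorem fracInst_eq (l : Coweight) : fracInst l =
    kac l a1 + kac l a2 + kac l a3 + kac l a4 + kac l a5 + kac l a6
      + min ((kac l b3 + kac l b4) / 2) ((kac l b2 + kac l b3 + 2 * kac l b4) / 3) := by
  have h2 := Rat.floor_intCast_div_natCast (kac l b3 + kac l b4) 2
  have h3 := Rat.floor_intCast_div_natCast (kac l b2 + kac l b3 + 2 * kac l b4) 3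
  push_cast at h2 h3
  rw [fracInst]
  push_cast
  rw [h2, h3]

theorem admissible_of_add_simple {l : Coweight} {i : Node}
    (h : Admissible (l + ofCoroot (simple i))) : Admissible l := by
  rw [Admissible, fracInst_eq, level_add_ofCoroot, central_add_ofCoroot] at *
  simp only [kac_add_ofCoroot, form_simple_simple] at h
  cases i <;> simp [cartan, dynkin, simple_apply] at h <;> omega

theorem ofCoroot_zero : ofCoroot 0 = 0 := rfl

theorem ofCoroot_add (x y : RootLattice) : ofCoroot (x + y) = ofCoroot x + ofCoroot y := by
  simp [ofCoroot]

theorem sum_pos_of_nonneg {x : RootLattice} (hx : 0 ≤ x) (hx0 : x ≠ 0) : 0 < ∑ i, x i := by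
  refine (Finset.sum_nonneg fun i _ => hx i).lt_of_ne' fun h => hx0 ?_
  funext i
  exact (Finset.sum_eq_zero_iff_of_nonneg fun i _ => hx i).1 h i (Finset.mem_univ i)

theorem admissible_of_add {l : Coweight} {x : RootLattice} (hx : 0 ≤ x)
    (h : Admissible (l + ofCoroot x)) : Admissible l := by
  obtain ⟨n, hn⟩ : ∃ n : ℕ, ∑ i, x i ≤ n := ⟨(∑ i, x i).toNat, Int.self_le_toNat _⟩
  induction n generalizing x with
  | zero =>
    have : x = 0 := by
      by_contra hc
      have := sum_pos_of_nonneg hx hc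
      push_cast at hn; omega
    rw [this] at h
    rwa [ofCoroot_zero, add_zero] at h
  | succ n ih =>
    by_cases hx0 : x = 0
    · rw [hx0] at h
      rwa [ofCoroot_zero, add_zero] at h
    obtain ⟨i, hi⟩ : ∃ i, 1 ≤ x i := by
      by_contra! hc
      refine hx0 (le_antisymm (fun i => ?_) hx)
      have := hc i
      simp only [Pi.zero_apply]; omega
    have hle : simple i ≤ x := fun j => by
      rw [simple_apply]
      split_ifs with h
      · rw [h]; exact hi
      · exact hx j
    refine ih (sub_nonneg.2 hle) (admissible_of_add_simple (i := i) ?_) ?_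
    · rwa [add_assoc, ← ofCoroot_add, sub_add_cancel]
    · have : ∑ j, simple i j = 1 := by simp [simple_apply]
      simp only [Pi.sub_apply, Finset.sum_sub_distrib, this]
      push_cast at hn; omega

theorem anomaly_add_lt {l : Coweight} (hl : Dominant l) (hk : 1 < level l)
    {x : RootLattice} (hx : 0 ≤ x) (hx0 : x ≠ 0) (hm : Dominant (l + ofCoroot x))
    (ham : Admissible (l + ofCoroot x)) : anomaly (l + ofCoroot x) < anomaly l := by
  obtain ⟨n, hn⟩ : ∃ n : ℕ, ∑ i, x i ≤ n := ⟨(∑ i, x i).toNat, Int.self_le_toNat _⟩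
  induction n generalizing l x with
  | zero =>
    have := sum_pos_of_nonneg hx hx0
    push_cast at hn; omega
  | succ n ih =>
    obtain ⟨β, hβ, hβ0, hle, hd, hlt⟩ := exists_degeneration hl hk hx hx0 hm
    have hlt := hlt (admissible_of_add hx ham)
    by_cases hxβ : x = β
    · rw [hxβ]; linarith
    have e : l + ofCoroot x = l + ofCoroot β + ofCoroot (x - β) := by
      rw [add_assoc, ← ofCoroot_add, add_sub_cancel]
    rw [e] at hm ham ⊢
    refine (ih hd (by rwa [level_add_ofCoroot]) (sub_nonneg.2 hle) (sub_ne_zero.2 hxβ) hm ham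
      ?_).trans (by linarith)
    have := sum_pos_of_nonneg hβ hβ0
    simp only [Pi.sub_apply, Finset.sum_sub_distrib]
    push_cast at hn; omega

theorem Le.exists_eq_add {l m : Coweight} (h : Le l m) :
    ∃ x : RootLattice, 0 ≤ x ∧ m = l + ofCoroot x := by
  obtain ⟨x, hx⟩ := h
  refine ⟨fun i => x i, fun i => Int.natCast_nonneg _, ?_⟩
  rw [← sub_eq_iff_eq_add', hx]
  have e : (fun i => (x i : ℤ)) = ∑ i, x i • simple i := by
    funext j
    simp [Finset.sum_apply, simple_apply]
  rw [e]
  ext1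
  · simp [ofCoroot, Prod.fst_sum]
  · simp [ofCoroot, Prod.snd_sum]

end AffineE8

theorem mainTheorem1 :
    -- minimal degenerations of types (i) and (ii)
    (∀ l : AffineE8.Coweight, AffineE8.Dominant l → 1 < AffineE8.level l →
      AffineE8.Admissible l →
      (∀ (I : Set Node) (β : AffineE8.RootLattice),
        AffineE8.IsZeroComponent l I → AffineE8.IsHighestRoot I β →
        0 < AffineE8.anomaly l - AffineE8.anomaly (l + AffineE8.ofCoroot β)) ∧
      (∀ i : Node, (∀ j : Node, AffineE8.dynkin.Adj i j → 0 < AffineE8.kac l j) →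
        0 < AffineE8.anomaly l -
          AffineE8.anomaly (l + AffineE8.ofCoroot (AffineE8.simple i)))) ∧
    -- hence all relations of the dominance order
    (∀ l m : AffineE8.Coweight, AffineE8.Dominant l → AffineE8.Dominant m →
      1 < AffineE8.level l → AffineE8.Admissible l → AffineE8.Admissible m →
      AffineE8.Le l m → l ≠ m →
      AffineE8.anomaly m < AffineE8.anomaly l) := by
  refine ⟨fun l hl hk ha => ⟨fun I β hI hβ =>
    AffineE8.anomaly_add_highestRoot_lt hl hk ha hI.zeroComponent hβ,
    fun i hi => AffineE8.anomaly_add_simple_lt hl hk ha hi⟩, fun l m hl hm hk _ ham hlm hne => ?_⟩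
  obtain ⟨x, hx, rfl⟩ := hlm.exists_eq_add
  refine AffineE8.anomaly_add_lt hl hk hx ?_ hm ham
  rintro rfl
  exact hne (by simp [AffineE8.ofCoroot])
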